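/- **Proposition C.1 (non-boundary case, from the time domain to the spectral domain).** Let $X=\{X_n\}_{n\in\mathbb Z}$ be a real second-order stationary time series with autocovariance function $\gamma_X(h)=\operatorname{Cov}(X_h,X_0)$. Let $\lambda_0\in(0,\pi)$, $d\in(0,\tfrac12)$, $c_\gamma\in(0,\infty)$, $\phi\in\left(\left(d-\tfrac12\right)\pi,\left(\tfrac12-d\right)\pi\right)$, and suppose that $X$ exhibits cyclical long memory in the time domain: $$\gamma_X(h)=\bigl(c_\gamma\cos(\lambda_0h+\phi)+R_\gamma(h)\bigr)h^{2d-1},\qquad h=1,2,\dots,$$ where $R_\gamma:[0,\infty)\to\mathbb R$ satisfies $R_\gamma(x)\to0$ as $x\to+\infty$. Assume that for all integers $h\ge1$ $$R_\gamma(h)=\bigl(L_{1,\gamma}(h)-c_\gamma\cos\phi\bigr)\cos(\lambda_0h)+\operatorname{sign}(-\sin\phi)\,\bigl(L_{2,\gamma}(h)-|c_\gamma\sin\phi|\bigr)\sin(\lambda_0h),$$ with $\operatorname{sign}(0)=0$, where $L_{1,\gamma},L_{2,\gamma}:(0,\infty)\to(0,\infty)$ are quasi-monotone slowly varying functions at $+\infty$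 such that $L_{1,\gamma}(x)\to c_\gamma\cos\phi$ and, if $\phi\ne0$, $L_{2,\gamma}(x)\to|c_\gamma\sin\phi|$ as $x\to+\infty$. (A slowly varying $L:(0,\infty)\to(0,\infty)$ is quasi-monotone if it is of bounded variation on every compact interval of $(0,\infty)$ and, for some $\delta>0$, $\int_{(0,x]}u^\delta\,|dL(u)|=O(x^\delta L(x))$ as $x\to\infty$, where $|dL|$ is integration against the total variation of $L$.) Put $$c_f^\pm=\frac{c_\gamma}{2\pi}\,\Gamma(2d)\cos(\pi d\mp\phi).$$ Then $c_f^+,c_f^->0$ and $X$ exhibits cyclical long memory in the spectral domain with these constants: $X$ has a spectral density $f_X\ge0$, integrable on $(-\pi,\pi)$ with $\gamma_X(h)=\int_{-\pi}^{\pi}e^{ih\lambda}f_X(\lambda)\,d\lambda$ for all $h\in\mathbb Z$, and there are functions $R_f^\pm:(0,\infty)\to[-c_f^\pm,\infty)$ with $R_f^\pm(x)\to0$ as $x\to0^+$ such that (for a suitable version of $f_X$) $$f_X(\lambda)=\begin{cases}\bigl(c_f^-+R_f^-(\lambda_0-\lambda)\bigr)(\lambda_0-\lambda)^{-2d},&0<\lambda<\lambda_0,\\[2pt]\bigl(c_f^++R_f^+(\lambda-\lambda_0)\bigr)(\lambda-\lambda_0)^{-2d},&\lambda_0<\lambda<\pi.\end{cases}$$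 -/

import Mathlib

open MeasureTheory ProbabilityTheory Filter Topology Set
open scoped ENNReal

noncomputable section

namespace CLM

/-- Second-order stationarity of a real time series indexed by the integers: finite second moments,
constant mean, and covariances which depend only on the lag. -/
structure IsSecondOrderStationary {Ω : Type*} [MeasurableSpace Ω] (μ : Measure Ω)
    (X : ℤ → Ω → ℝ) : Prop where
  memLp : ∀ n, MemLp (X n) 2 μ
  mean_eq : ∀ n, ∫ ω, X n ω ∂μ = ∫ ω, X 0 ω ∂μ
  cov_eq : ∀ n h, covariance (X (n + h)) (X n) μ = covariance (X h) (X 0) μ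

/-- The autocovariance function. -/
def acvf {Ω : Type*} [MeasurableSpace Ω] (μ : Measure Ω) (X : ℤ → Ω → ℝ) (h : ℤ) : ℝ :=
  covariance (X h) (X 0) μ

/-- `f` is (a version of) the spectral density on `(-π, π)` of a series with autocovariance
function `γ`. -/
structure IsSpectralDensity (γ : ℤ → ℝ) (f : ℝ → ℝ) : Prop where
  nonneg : ∀ x ∈ Ioo (-Real.pi) Real.pi, 0 ≤ f x
  integrable : IntegrableOn f (Ioo (-Real.pi) Real.pi)
  fourier : ∀ h : ℤ, (γ h : ℂ) =
    ∫ x in Ioo (-Real.pi) Real.pi, Complex.exp (Complex.I * h * x) * (f x : ℂ)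

/-- Cyclical long memory in the time domain, with cyclical frequency `lam`, memory parameter `d`,
constant `c`, cyclical phase `φ` and remainder function `R` (only its values on `[0, ∞)` matter).
The lag `0` is left out because `0 ^ (2 * d - 1)` has a negative exponent. -/
structure IsCLMTime {Ω : Type*} [MeasurableSpace Ω] (μ : Measure Ω) (X : ℤ → Ω → ℝ)
    (lam d c φ : ℝ) (R : ℝ → ℝ) : Prop where
  stationary : IsSecondOrderStationary μ X
  lam_mem : lam ∈ Ioo 0 Real.pi
  d_mem : d ∈ Ioo (0 : ℝ) (1 / 2)
  c_pos : 0 < c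
  phase_mem : φ ∈ Icc (-((1 / 2 - d) * Real.pi)) ((1 / 2 - d) * Real.pi)
  remainder : Tendsto R atTop (𝓝 0)
  acvf_eq : ∀ h : ℕ, 1 ≤ h →
    acvf μ X h = (c * Real.cos (lam * h + φ) + R h) * (h : ℝ) ^ (2 * d - 1)

/-- Cyclical long memory in the spectral domain, with cyclical frequency `lam`, memory parameter
`d`, and constants `cm` (left of `lam`) and `cp` (right of `lam`). -/
structure IsCLMSpectral {Ω : Type*} [MeasurableSpace Ω] (μ : Measure Ω) (X : ℤ → Ω → ℝ)
    (lam d cm cp : ℝ) : Prop where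
  stationary : IsSecondOrderStationary μ X
  lam_mem : lam ∈ Ioo 0 Real.pi
  d_mem : d ∈ Ioo (0 : ℝ) (1 / 2)
  cm_nonneg : 0 ≤ cm
  cp_nonneg : 0 ≤ cp
  sum_pos : 0 < cm + cp
  density : ∃ f Rm Rp : ℝ → ℝ, IsSpectralDensity (acvf μ X) f ∧
    (∀ x, 0 < x → -cm ≤ Rm x) ∧ (∀ x, 0 < x → -cp ≤ Rp x) ∧
    Tendsto Rm (𝓝[>] 0) (𝓝 0) ∧ Tendsto Rp (𝓝[>] 0) (𝓝 0) ∧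
    (∀ x ∈ Ioo 0 lam, f x = (cm + Rm (lam - x)) * (lam - x) ^ (-2 * d)) ∧
    (∀ x ∈ Ioo lam Real.pi, f x = (cp + Rp (x - lam)) * (x - lam) ^ (-2 * d))

/-- Slow variation at infinity of a function `(0, ∞) → (0, ∞)`; the values of `L` outside `(0, ∞)`
are irrelevant. -/
structure IsSlowlyVarying (L : ℝ → ℝ) : Prop where
  pos : ∀ x, 0 < x → 0 < L x
  measurable : Measurable (fun x : Ioi (0 : ℝ) => L x)
  tendsto : ∀ a, 0 < a → Tendsto (fun x => L (a * x) / L x) atTop (𝓝 1)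

/-- The Stieltjes integral `∫_{(0, x]} u ^ δ |dL(u)|` of the increasing continuous function `u ^ δ`
(for `δ > 0`) against the total variation of `L`, as the supremum of the lower Darboux sums
`∑ i, u_i ^ δ * Var(L; [u_i, u_{i+1}])` over all partitions `u_0 ≤ u_1 ≤ ... ≤ u_n`
of subintervals of `(0, x]`. -/
def variationIntegral (δ : ℝ) (L : ℝ → ℝ) (x : ℝ) : ℝ≥0∞ :=
  ⨆ p : ℕ × {u : ℕ → ℝ // Monotone u ∧ ∀ i, u i ∈ Ioc 0 x},
    ∑ i ∈ Finset.range p.1,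
      ENNReal.ofReal ((p.2 : ℕ → ℝ) i ^ δ) *
        eVariationOn L (Icc ((p.2 : ℕ → ℝ) i) ((p.2 : ℕ → ℝ) (i + 1)))

/-- Quasi-monotone slowly varying functions `(0, ∞) → (0, ∞)`: bounded variation on compact
intervals, and `∫_{(0, x]} u ^ δ |dL(u)| = O(x ^ δ L(x))` as `x → ∞` for some `δ > 0`. -/
structure IsQuasiMonotone (L : ℝ → ℝ) : Prop where
  slowlyVarying : IsSlowlyVarying L
  boundedVariation : ∀ a b, 0 < a → a ≤ b → BoundedVariationOn L (Icc a b)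
  integral_bound : ∃ δ : ℝ, 0 < δ ∧ ∃ C : ℝ, ∀ᶠ x in atTop,
    variationIntegral δ L x ≤ ENNReal.ofReal (C * (x ^ δ * L x))

end CLM

end

/-!
The hypothesis on the remainder says precisely that, with `s = sign (-sin φ)`,
`γ(h) = a h * cos (lam h) + b h * sin (lam h)` for `h ≥ 1`, where `a h = L₁ h * h ^ (2 d - 1)` and
`b h = s * L₂ h * h ^ (2 d - 1)` (`CLM.IsCLMTime.acvf_eq_modulated`). The symmetric Fourier sums of
`γ` are therefore combinations of the trigonometric series `∑ a h * exp (i h θ)` and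
`∑ b h * exp (i h θ)` at `θ = x ± lam` (`CLM.fourierSum_eq_of_modulated`), and everything reduces to
such series.

Write `β = 2 d`. Quasi-monotonicity is used only through the bound it gives for the variation of
`L₁` and `L₂` over dyadic blocks, which makes the variation of the coefficients on `[n, ∞)` of order
`n ^ (β - 1)`, the order of the coefficients themselves (`CLM.IsQuasiMonotone.exists_powerDecay`).
Summing trivially up to about `1 / |θ|` and by parts beyond, one finds that the series converges for
`θ ≠ 0` mod `2π`, with partial sums `O(|θ| ^ (-β))`
(`CLM.PowerDecay.exists_norm_partialSum_le`); the same splitting shows that coefficients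
`o(n ^ (β - 1))` give a sum `o(θ ^ (-β))`
(`CLM.PowerDecay.tendsto_rpow_mul_norm_seriesSum`). The exact constant is obtained by comparison
with the binomial series `(1 - z) ^ (-β)`, whose coefficients are asymptotic to
`n ^ (β - 1) / Γ(β)` and whose sum on the unit circle is explicit by Abel's limit theorem: if the
coefficients are asymptotic to `ℓ * n ^ (β - 1)`, the sum is asymptotic to
`ℓ * Γ(β) * exp (i π β / 2) * θ ^ (-β)` as `θ → 0+`
(`CLM.PowerDecay.tendsto_rpow_mul_seriesSum`).

The limit of the Fourier sums, divided by `2π`, is the spectral density. It is nonnegative because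
it is also the limit of the Cesàro sums, which are nonnegative since `γ` is positive semidefinite
(`CLM.IsSecondOrderStationary.nonneg_of_tendsto_fourierSum`); it has the right Fourier coefficients
by dominated convergence, as `|θ| ^ (-β)` is integrable near `0` for `β < 1`
(`CLM.isSpectralDensity_of_tendsto`). Near `lam` only the series at `θ = x - lam` is singular; its
cosine part is even in `θ` and its sine part is odd, whence the constants proportional to
`cos φ cos (π d) ± sin φ sin (π d)` on the two sides (`CLM.tendsto_rpow_mul_modulatedSum`).
-/

namespace CLM

/-! ### Trigonometric series with coefficients of power decay -/

/-- The coefficients `a n` are of order `n ^ (β - 1)`, and so is their total variation on `[n, ∞)`,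
both with constant `C`. The value `a 0` is unrestricted. -/
structure PowerDecay (β C : ℝ) (a : ℕ → ℝ) : Prop where
  abs_le : ∀ n : ℕ, 1 ≤ n → |a n| ≤ C * (n : ℝ) ^ (β - 1)
  var_le : ∀ M N : ℕ, 1 ≤ M →
    ∑ n ∈ Finset.Ico M N, |a (n + 1) - a n| ≤ C * (M : ℝ) ^ (β - 1)

namespace PowerDecay

variable {β C C' : ℝ} {a b : ℕ → ℝ}

lemma nonneg (h : PowerDecay β C a) : 0 ≤ C := by
  have := h.abs_le 1 le_rfl
  simp only [Nat.cast_one, Real.one_rpow, mul_one] at this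
  exact (abs_nonneg _).trans this

lemma const_mul (h : PowerDecay β C a) (s : ℝ) :
    PowerDecay β (|s| * C) (fun n => s * a n) where
  abs_le n hn := by
    rw [abs_mul, mul_assoc]
    exact mul_le_mul_of_nonneg_left (h.abs_le n hn) (abs_nonneg s)
  var_le M N hM := by
    simp_rw [← mul_sub, abs_mul, ← Finset.mul_sum, mul_assoc]
    exact mul_le_mul_of_nonneg_left (h.var_le M N hM) (abs_nonneg s)

lemma sub (h : PowerDecay β C a) (h' : PowerDecay β C' b) :
    PowerDecay β (C + C') (fun n => a n - b n) where
  abs_le n hn := by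
    rw [add_mul]
    exact (abs_sub _ _).trans (add_le_add (h.abs_le n hn) (h'.abs_le n hn))
  var_le M N hM := by
    rw [add_mul]
    refine le_trans ?_ (add_le_add (h.var_le M N hM) (h'.var_le M N hM))
    rw [← Finset.sum_add_distrib]
    refine Finset.sum_le_sum fun n _ => ?_
    rw [show a (n + 1) - b (n + 1) - (a n - b n) = a (n + 1) - a n - (b (n + 1) - b n) by ring]
    exact abs_sub _ _

/-- A nonincreasing sequence of order `n ^ (β - 1)` has power decay: its variation on `[n, ∞)`
telescopes. -/
lemma of_antitone (hpos : ∀ n, 0 ≤ a n) (hanti : Antitone a)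
    (hle : ∀ n : ℕ, 1 ≤ n → a n ≤ C * (n : ℝ) ^ (β - 1)) : PowerDecay β C a where
  abs_le n hn := by
    rw [abs_of_nonneg (hpos n)]
    exact hle n hn
  var_le M N hM := by
    refine le_trans ?_ (hle M hM)
    rcases le_total N M with hNM | hMN
    · simp [Finset.Ico_eq_empty_of_le hNM, hpos M]
    · have : ∀ n ∈ Finset.Ico M N, |a (n + 1) - a n| = -(a (n + 1) - a n) := fun n _ =>
        abs_of_nonpos (sub_nonpos.2 (hanti n.le_succ))
      rw [Finset.sum_congr rfl this, Finset.sum_neg_distrib, Finset.sum_Ico_sub a hMN]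
      linarith [hpos N]

end PowerDecay

/-- Summation by parts for a block of a power series. -/
lemma one_sub_mul_sum_Ico (a : ℕ → ℂ) (z : ℂ) {M N : ℕ} (hMN : M ≤ N) :
    (1 - z) * ∑ n ∈ Finset.Ico M N, a n * z ^ n =
      a M * z ^ M - a N * z ^ N + ∑ n ∈ Finset.Ico M N, (a (n + 1) - a n) * z ^ (n + 1) := by
  induction N, hMN using Nat.le_induction with
  | base => simp
  | succ N hMN ih =>
    rw [Finset.sum_Ico_succ_top hMN, Finset.sum_Ico_succ_top hMN, mul_add, ih]
    ring

variable {β C : ℝ} {a : ℕ → ℝ}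

lemma PowerDecay.norm_sum_Ico_le (h : PowerDecay β C a) (hβ : β < 1) {z : ℂ} (hz : ‖z‖ = 1)
    (hz1 : z ≠ 1) {M N : ℕ} (hM : 1 ≤ M) (hMN : M ≤ N) :
    ‖∑ n ∈ Finset.Ico M N, (a n : ℂ) * z ^ n‖ ≤ 3 * C * (M : ℝ) ^ (β - 1) / ‖1 - z‖ := by
  have hpos : 0 < ‖1 - z‖ := norm_pos_iff.2 (sub_ne_zero.2 hz1.symm)
  rw [le_div_iff₀' hpos, ← norm_mul, one_sub_mul_sum_Ico (fun n => (a n : ℂ)) z hMN]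
  have h1 : ‖(a M : ℂ) * z ^ M‖ ≤ C * (M : ℝ) ^ (β - 1) := by
    simpa [hz] using h.abs_le M hM
  have h2 : ‖(a N : ℂ) * z ^ N‖ ≤ C * (M : ℝ) ^ (β - 1) := by
    have := h.abs_le N (hM.trans hMN)
    have hmono : (N : ℝ) ^ (β - 1) ≤ (M : ℝ) ^ (β - 1) :=
      Real.rpow_le_rpow_of_nonpos (by exact_mod_cast hM) (by exact_mod_cast hMN) (by linarith)
    simpa [hz] using this.trans (mul_le_mul_of_nonneg_left hmono h.nonneg)
  have h3 : ‖∑ n ∈ Finset.Ico M N, ((a (n + 1) : ℂ) - a n) * z ^ (n + 1)‖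
      ≤ C * (M : ℝ) ^ (β - 1) := by
    refine (norm_sum_le _ _).trans ((Finset.sum_le_sum fun n _ => ?_).trans (h.var_le M N hM))
    rw [norm_mul, norm_pow, hz, one_pow, mul_one, ← Complex.ofReal_sub, Complex.norm_real,
      Real.norm_eq_abs]
  have h4 := norm_add_le ((a M : ℂ) * z ^ M - a N * z ^ N)
    (∑ n ∈ Finset.Ico M N, ((a (n + 1) : ℂ) - a n) * z ^ (n + 1))
  have h5 := norm_sub_le ((a M : ℂ) * z ^ M) ((a N : ℂ) * z ^ N)
  linarith

/-- The partial sums of `∑ a n * z ^ n`. -/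
noncomputable def partialSum (a : ℕ → ℝ) (z : ℂ) (N : ℕ) : ℂ :=
  ∑ n ∈ Finset.range N, (a n : ℂ) * z ^ n

/-- The sum of `∑ a n * z ^ n`, as a limit of partial sums, since the series need not converge
absolutely (junk value where it diverges). -/
noncomputable def seriesSum (a : ℕ → ℝ) (z : ℂ) : ℂ :=
  limUnder atTop (partialSum a z)

lemma PowerDecay.norm_partialSum_sub_le (h : PowerDecay β C a) (hβ : β < 1) {z : ℂ}
    (hz : ‖z‖ = 1) (hz1 : z ≠ 1) {M N : ℕ} (hM : 1 ≤ M) (hMN : M ≤ N) :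
    ‖partialSum a z N - partialSum a z M‖ ≤ 3 * C * (M : ℝ) ^ (β - 1) / ‖1 - z‖ := by
  rw [partialSum, partialSum, ← Finset.sum_Ico_eq_sub _ hMN]
  exact h.norm_sum_Ico_le hβ hz hz1 hM hMN

lemma PowerDecay.tendsto_partialSum (h : PowerDecay β C a) (hβ : β < 1) {z : ℂ}
    (hz : ‖z‖ = 1) (hz1 : z ≠ 1) :
    Tendsto (partialSum a z) atTop (𝓝 (seriesSum a z)) := by
  have hlim : Tendsto (fun M : ℕ => 3 * C * (M : ℝ) ^ (β - 1) / ‖1 - z‖) atTop (𝓝 0) := by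
    have := (tendsto_rpow_neg_atTop (y := 1 - β) (by linarith)).comp
      tendsto_natCast_atTop_atTop
    simpa [Function.comp_def] using (this.const_mul (3 * C)).div_const ‖1 - z‖
  have hc : CauchySeq (partialSum a z) := by
    rw [Metric.cauchySeq_iff']
    intro ε hε
    obtain ⟨M, hM, hM1⟩ := ((hlim.eventually (gt_mem_nhds hε)).and (eventually_ge_atTop 1)).exists
    refine ⟨M, fun N hN => ?_⟩
    rw [dist_eq_norm]
    exact (h.norm_partialSum_sub_le hβ hz hz1 hM1 hN).trans_lt hM
  exact hc.tendsto_limUnder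

/-- The first `M` terms are summed trivially, and the tail is bounded by summation by parts;
`M` of order `|1 - z|⁻¹` is the good choice. -/
lemma PowerDecay.norm_partialSum_le (h : PowerDecay β C a) (hβ : β < 1) {z : ℂ}
    (hz : ‖z‖ = 1) (hz1 : z ≠ 1) {M : ℕ} (hM : 1 ≤ M) (N : ℕ) :
    ‖partialSum a z N‖ ≤
      ∑ n ∈ Finset.range M, |a n| + 3 * C * (M : ℝ) ^ (β - 1) / ‖1 - z‖ := by
  have htriv : ∀ K ≤ M, ‖partialSum a z K‖ ≤ ∑ n ∈ Finset.range M, |a n| := fun K hK =>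
    calc ‖partialSum a z K‖ ≤ ∑ n ∈ Finset.range K, ‖(a n : ℂ) * z ^ n‖ := norm_sum_le _ _
      _ = ∑ n ∈ Finset.range K, |a n| := by simp [hz]
      _ ≤ _ := Finset.sum_le_sum_of_subset_of_nonneg (Finset.range_mono hK)
          fun _ _ _ => abs_nonneg _
  have hC := h.nonneg
  rcases le_total N M with hNM | hMN
  · exact (htriv N hNM).trans (le_add_of_nonneg_right (by positivity))
  · have h1 := h.norm_partialSum_sub_le hβ hz hz1 hM hMN
    have h2 := norm_add_le (partialSum a z M) (partialSum a z N - partialSum a z M)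
    rw [add_sub_cancel] at h2
    linarith [htriv M le_rfl]

lemma PowerDecay.norm_seriesSum_le (h : PowerDecay β C a) (hβ : β < 1) {z : ℂ}
    (hz : ‖z‖ = 1) (hz1 : z ≠ 1) {M : ℕ} (hM : 1 ≤ M) :
    ‖seriesSum a z‖ ≤ ∑ n ∈ Finset.range M, |a n| + 3 * C * (M : ℝ) ^ (β - 1) / ‖1 - z‖ :=
  le_of_tendsto (h.tendsto_partialSum hβ hz hz1).norm
    (Eventually.of_forall fun N => h.norm_partialSum_le hβ hz hz1 hM N)

/-- `n ^ (β - 1)` is at most the increment of `x ^ β / β` over `[n - 1, n]`. -/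
lemma sum_rpow_sub_one_le (hβ0 : 0 < β) (hβ : β ≤ 1) (M : ℕ) :
    ∑ n ∈ Finset.Ico 1 M, (n : ℝ) ^ (β - 1) ≤ (M : ℝ) ^ β / β := by
  have key : ∀ M : ℕ, ∑ n ∈ Finset.range M, ((n + 1 : ℕ) : ℝ) ^ (β - 1) ≤ (M : ℝ) ^ β / β := by
    intro M
    induction M with
    | zero => simp [Real.zero_rpow hβ0.ne']
    | succ M ih =>
      rw [Finset.sum_range_succ]
      have hM : (0 : ℝ) < ((M + 1 : ℕ) : ℝ) := by positivity
      have hb := rpow_one_add_le_one_add_mul_self (s := -1 / ((M + 1 : ℕ) : ℝ))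
        (by rw [le_div_iff₀ hM]; push_cast; linarith [M.cast_nonneg (α := ℝ)]) hβ0.le hβ
      have e1 : 1 + -1 / ((M + 1 : ℕ) : ℝ) = (M : ℝ) / ((M + 1 : ℕ) : ℝ) := by
        field_simp
        push_cast
        ring
      rw [e1, Real.div_rpow M.cast_nonneg hM.le, div_le_iff₀ (by positivity)] at hb
      have e2 : ((M + 1 : ℕ) : ℝ) ^ (β - 1) = ((M + 1 : ℕ) : ℝ) ^ β / ((M + 1 : ℕ) : ℝ) :=
        Real.rpow_sub_one hM.ne' β
      rw [e2]
      have e3 : (1 + β * (-1 / ((M + 1 : ℕ) : ℝ))) * ((M + 1 : ℕ) : ℝ) ^ β =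
          ((M + 1 : ℕ) : ℝ) ^ β - β * (((M + 1 : ℕ) : ℝ) ^ β / ((M + 1 : ℕ) : ℝ)) := by ring
      rw [e3] at hb
      rw [le_div_iff₀ hβ0] at ih ⊢
      linarith
  rcases M with _ | M
  · simp [Real.zero_rpow hβ0.ne']
  · rw [Finset.sum_Ico_eq_sum_range, Nat.add_sub_cancel]
    simp_rw [add_comm 1]
    refine (key M).trans ?_
    gcongr
    simp

lemma PowerDecay.sum_abs_le (h : PowerDecay β C a) (hβ0 : 0 < β) (hβ : β ≤ 1) {M : ℕ}
    (hM : 1 ≤ M) :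
    ∑ n ∈ Finset.range M, |a n| ≤ |a 0| + C * ((M : ℝ) ^ β / β) := by
  rw [Finset.range_eq_Ico, Finset.sum_eq_sum_Ico_succ_bot hM]
  gcongr
  calc ∑ n ∈ Finset.Ico 1 M, |a n| ≤ ∑ n ∈ Finset.Ico 1 M, C * (n : ℝ) ^ (β - 1) :=
        Finset.sum_le_sum fun n hn => h.abs_le n (Finset.mem_Ico.1 hn).1
    _ ≤ _ := by
        rw [← Finset.mul_sum]
        exact mul_le_mul_of_nonneg_left (sum_rpow_sub_one_le hβ0 hβ M) h.nonneg

/-- If `a n = o(n ^ (β - 1))`, then `∑_{n < M} |a n| = o(M ^ β)`. -/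
lemma tendsto_sum_abs_div_rpow (hβ0 : 0 < β) (hβ : β ≤ 1)
    (ha : Tendsto (fun n : ℕ => a n / (n : ℝ) ^ (β - 1)) atTop (𝓝 0)) :
    Tendsto (fun M : ℕ => (∑ n ∈ Finset.range M, |a n|) / (M : ℝ) ^ β) atTop (𝓝 0) := by
  rw [Metric.tendsto_atTop]
  intro ε hε
  have hε' : 0 < ε * β / 2 := by positivity
  obtain ⟨H, hH⟩ := Metric.tendsto_atTop.1 ha _ hε'
  set D := ∑ n ∈ Finset.range (H + 1), |a n| with hD
  have hD0 : 0 ≤ D := Finset.sum_nonneg fun _ _ => abs_nonneg _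
  have hpow : Tendsto (fun M : ℕ => D / (M : ℝ) ^ β) atTop (𝓝 0) :=
    ((tendsto_rpow_atTop hβ0).comp tendsto_natCast_atTop_atTop).const_div_atTop D
  obtain ⟨M₀, hM₀⟩ := eventually_atTop.1 (hpow.eventually (gt_mem_nhds (half_pos hε)))
  refine ⟨max M₀ (H + 1), fun M hM => ?_⟩
  have hMH : H + 1 ≤ M := (le_max_right _ _).trans hM
  have hMpos : (0 : ℝ) < (M : ℝ) ^ β := Real.rpow_pos_of_pos (by norm_cast; omega) _
  have hbound : ∑ n ∈ Finset.range M, |a n| ≤ D + ε * β / 2 * ((M : ℝ) ^ β / β) := by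
    rw [← Finset.sum_range_add_sum_Ico _ hMH]
    gcongr
    calc ∑ n ∈ Finset.Ico (H + 1) M, |a n|
        ≤ ∑ n ∈ Finset.Ico (H + 1) M, ε * β / 2 * (n : ℝ) ^ (β - 1) := by
          refine Finset.sum_le_sum fun n hn => ?_
          have hn := (Finset.mem_Ico.1 hn).1
          have hnpos : (0 : ℝ) < (n : ℝ) ^ (β - 1) := Real.rpow_pos_of_pos (by norm_cast; omega) _
          have := hH n (by omega)
          rw [dist_zero_right, Real.norm_eq_abs, abs_div, abs_of_pos hnpos,
            div_lt_iff₀ hnpos] at this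
          exact this.le
      _ ≤ ∑ n ∈ Finset.Ico 1 M, ε * β / 2 * (n : ℝ) ^ (β - 1) :=
          Finset.sum_le_sum_of_subset_of_nonneg (Finset.Ico_subset_Ico_left (by omega))
            fun _ _ _ => by positivity
      _ ≤ _ := by
          rw [← Finset.mul_sum]
          exact mul_le_mul_of_nonneg_left (sum_rpow_sub_one_le hβ0 hβ M) hε'.le
  have h1 := hM₀ M ((le_max_left _ _).trans hM)
  rw [dist_zero_right, Real.norm_of_nonneg
    (div_nonneg (Finset.sum_nonneg fun _ _ => abs_nonneg _) hMpos.le)]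
  calc (∑ n ∈ Finset.range M, |a n|) / (M : ℝ) ^ β
      ≤ (D + ε * β / 2 * ((M : ℝ) ^ β / β)) / (M : ℝ) ^ β := by gcongr
    _ = D / (M : ℝ) ^ β + ε / 2 := by field_simp
    _ < ε := by linarith

end CLM

namespace CLM

variable {β C : ℝ} {a : ℕ → ℝ}

/-- On `[-T, T]` with `T < 2π`, the chord `|1 - exp (iθ)|` is at least a multiple of `|θ|`. -/
lemma exists_mul_abs_le_norm_one_sub_exp {T : ℝ} (hT0 : 0 < T) (hT : T < 2 * Real.pi) :
    ∃ κ : ℝ, 0 < κ ∧ ∀ θ : ℝ, |θ| ≤ T → κ * |θ| ≤ ‖1 - Complex.exp (θ * Complex.I)‖ := by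
  have hsin : 0 < Real.sin (T / 2) := Real.sin_pos_of_pos_of_lt_pi (by linarith) (by linarith)
  refine ⟨2 * Real.sin (T / 2) / T, by positivity, fun θ hθ => ?_⟩
  have hnorm : ‖1 - Complex.exp (θ * Complex.I)‖ = 2 * |Real.sin (|θ| / 2)| := by
    rw [norm_sub_rev, mul_comm, Complex.norm_exp_I_mul_ofReal_sub_one, Real.norm_eq_abs, abs_mul,
      abs_two]
    rcases abs_choice θ with h | h <;> rw [h]
    rw [neg_div, Real.sin_neg, abs_neg]
  have h0 : (0 : ℝ) ∈ Icc 0 Real.pi := ⟨le_rfl, Real.pi_pos.le⟩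
  have hT2 : T / 2 ∈ Icc 0 Real.pi := ⟨by linarith, by linarith⟩
  have hw : 0 ≤ 1 - |θ| / T := by rwa [sub_nonneg, div_le_one hT0]
  have hconc := strictConcaveOn_sin_Icc.concaveOn.2 h0 hT2 hw
    (by positivity : 0 ≤ |θ| / T) (by ring)
  simp only [smul_eq_mul, mul_zero, Real.sin_zero, zero_add] at hconc
  rw [show |θ| / T * (T / 2) = |θ| / 2 by field_simp] at hconc
  rw [hnorm]
  calc 2 * Real.sin (T / 2) / T * |θ| = 2 * (|θ| / T * Real.sin (T / 2)) := by ring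
    _ ≤ 2 * Real.sin (|θ| / 2) := by linarith
    _ ≤ _ := by linarith [le_abs_self (Real.sin (|θ| / 2))]

lemma exp_mul_I_ne_one {θ : ℝ} (h0 : θ ≠ 0) (h : |θ| < 2 * Real.pi) :
    Complex.exp (θ * Complex.I) ≠ 1 := by
  obtain ⟨κ, hκ, hle⟩ := exists_mul_abs_le_norm_one_sub_exp (abs_pos.2 h0) h
  have := hle θ le_rfl
  intro h1
  rw [h1, sub_self, norm_zero] at this
  exact absurd this (not_le.2 (mul_pos hκ (abs_pos.2 h0)))

/-- A uniform bound for the partial sums, with the singularity expected of the sum. -/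
lemma PowerDecay.exists_norm_partialSum_le (h : PowerDecay β C a) (hβ0 : 0 < β) (hβ : β < 1)
    {T : ℝ} (hT0 : 0 < T) (hT : T < 2 * Real.pi) :
    ∃ K : ℝ, 0 ≤ K ∧ ∀ θ : ℝ, θ ≠ 0 → |θ| ≤ T → ∀ N,
      ‖partialSum a (Complex.exp (θ * Complex.I)) N‖ ≤ K * |θ| ^ (-β) := by
  obtain ⟨κ, hκ, hle⟩ := exists_mul_abs_le_norm_one_sub_exp hT0 hT
  have hC := h.nonneg
  refine ⟨|a 0| * T ^ β + C * ((1 + T) ^ β / β) + 3 * C / κ, by positivity, fun θ h0 hθ N => ?_⟩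
  have ht : 0 < |θ| := abs_pos.2 h0
  set t := |θ| with ht_def
  set M := ⌈1 / t⌉₊ with hM_def
  have hMpos : 0 < M := Nat.ceil_pos.2 (by positivity)
  have hMge : 1 / t ≤ M := Nat.le_ceil _
  have hMle : (M : ℝ) ≤ (1 + T) / t := by
    have := (Nat.ceil_lt_add_one (by positivity : 0 ≤ 1 / t)).le
    refine this.trans ?_
    rw [add_div]
    gcongr
    rwa [le_div_iff₀ ht, one_mul]
  have h1 := h.norm_partialSum_le hβ (Complex.norm_exp_ofReal_mul_I θ)
    (exp_mul_I_ne_one h0 (hθ.trans_lt hT)) hMpos N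
  have h2 := h.sum_abs_le hβ0 hβ.le hMpos
  have e1 : |a 0| ≤ |a 0| * T ^ β * t ^ (-β) := by
    rw [mul_assoc, Real.rpow_neg ht.le, ← div_eq_mul_inv, ← Real.div_rpow hT0.le ht.le]
    exact le_mul_of_one_le_right (abs_nonneg _)
      (Real.one_le_rpow (by rwa [le_div_iff₀ ht, one_mul]) hβ0.le)
  have e2 : (M : ℝ) ^ β ≤ (1 + T) ^ β * t ^ (-β) := by
    rw [Real.rpow_neg ht.le, ← div_eq_mul_inv, ← Real.div_rpow (by positivity) ht.le]
    gcongr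
  have e3 : 3 * C * (M : ℝ) ^ (β - 1) / ‖1 - Complex.exp (θ * Complex.I)‖ ≤
      3 * C / κ * t ^ (-β) := by
    have hM1 : (M : ℝ) ^ (β - 1) ≤ t ^ (1 - β) := by
      have := Real.rpow_le_rpow_of_nonpos (by positivity) hMge (by linarith : β - 1 ≤ 0)
      rwa [one_div, Real.inv_rpow ht.le, ← Real.rpow_neg ht.le, neg_sub] at this
    calc 3 * C * (M : ℝ) ^ (β - 1) / ‖1 - Complex.exp (θ * Complex.I)‖
        ≤ 3 * C * t ^ (1 - β) / (κ * t) := by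
          gcongr
          exact hle θ hθ
      _ = 3 * C / κ * t ^ (-β) := by
          rw [show -β = (1 - β) - 1 by ring, Real.rpow_sub_one ht.ne']
          field_simp
  calc _ ≤ _ := h1
    _ ≤ (|a 0| * T ^ β * t ^ (-β) + C * ((1 + T) ^ β * t ^ (-β) / β)) +
        3 * C / κ * t ^ (-β) := by
        refine add_le_add (h2.trans (add_le_add e1 ?_)) e3
        gcongr
    _ = _ := by ring

/-- Coefficients that are `o(n ^ (β - 1))` give a sum that is `o(θ ^ (-β))`. The terms with
`n < K / θ` contribute `o(θ ^ (-β))` for each fixed `K`, and the tail at most a multiple of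
`K ^ (β - 1) * θ ^ (-β)`, which is small for large `K` because `β < 1`. -/
lemma PowerDecay.tendsto_rpow_mul_norm_seriesSum (h : PowerDecay β C a) (hβ0 : 0 < β)
    (hβ : β < 1) (ha : Tendsto (fun n : ℕ => a n / (n : ℝ) ^ (β - 1)) atTop (𝓝 0)) :
    Tendsto (fun θ : ℝ => θ ^ β * ‖seriesSum a (Complex.exp (θ * Complex.I))‖)
      (𝓝[>] 0) (𝓝 0) := by
  obtain ⟨κ, hκ, hle⟩ := exists_mul_abs_le_norm_one_sub_exp Real.pi_pos
    (by linarith [Real.pi_pos] : Real.pi < 2 * Real.pi)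
  have hC := h.nonneg
  set s : ℕ → ℝ := fun M => (∑ n ∈ Finset.range M, |a n|) / (M : ℝ) ^ β with hs
  have hs0 : ∀ M, 0 ≤ s M := fun M =>
    div_nonneg (Finset.sum_nonneg fun _ _ => abs_nonneg _) (by positivity)
  have bound : ∀ K : ℝ, 0 < K → ∀ θ ∈ Ioo (0 : ℝ) 1,
      θ ^ β * ‖seriesSum a (Complex.exp (θ * Complex.I))‖ ≤
        (K + 1) ^ β * s ⌈K / θ⌉₊ + 3 * C / κ * K ^ (β - 1) := by
    intro K hK θ ⟨hθ0, hθ1⟩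
    have hθπ : θ < Real.pi := hθ1.trans (by linarith [Real.pi_gt_three])
    set M := ⌈K / θ⌉₊ with hM_def
    have hMpos : 0 < M := Nat.ceil_pos.2 (by positivity)
    have hMge : K / θ ≤ M := Nat.le_ceil _
    have hMle : θ * M ≤ K + 1 := by
      have := (Nat.ceil_lt_add_one (by positivity : 0 ≤ K / θ)).le
      calc θ * (M : ℝ) ≤ θ * (K / θ + 1) := by gcongr
        _ = K + θ := by field_simp
        _ ≤ K + 1 := by linarith
    have h1 := h.norm_seriesSum_le hβ (Complex.norm_exp_ofReal_mul_I θ)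
      (exp_mul_I_ne_one hθ0.ne' (by rw [abs_of_pos hθ0]; linarith)) hMpos
    have hMβ : (0 : ℝ) < (M : ℝ) ^ β := by positivity
    have e1 : θ ^ β * ∑ n ∈ Finset.range M, |a n| ≤ (K + 1) ^ β * s M := by
      have : ∑ n ∈ Finset.range M, |a n| = (M : ℝ) ^ β * s M := by
        rw [hs]
        field_simp
      rw [this, ← mul_assoc, ← Real.mul_rpow hθ0.le (by positivity)]
      exact mul_le_mul_of_nonneg_right
        (Real.rpow_le_rpow (by positivity) hMle hβ0.le) (hs0 M)
    have e2 : θ ^ β * (3 * C * (M : ℝ) ^ (β - 1) / ‖1 - Complex.exp (θ * Complex.I)‖) ≤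
        3 * C / κ * K ^ (β - 1) := by
      have hM1 : (M : ℝ) ^ (β - 1) ≤ (K / θ) ^ (β - 1) :=
        Real.rpow_le_rpow_of_nonpos (by positivity) hMge (by linarith)
      have hκθ := hle θ (by rw [abs_of_pos hθ0]; exact hθπ.le)
      rw [abs_of_pos hθ0] at hκθ
      calc θ ^ β * (3 * C * (M : ℝ) ^ (β - 1) / ‖1 - Complex.exp (θ * Complex.I)‖)
          ≤ θ ^ β * (3 * C * (K / θ) ^ (β - 1) / (κ * θ)) := by gcongr
        _ = 3 * C / κ * K ^ (β - 1) := by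
          rw [Real.div_rpow hK.le hθ0.le, Real.rpow_sub_one hθ0.ne']
          have := Real.rpow_pos_of_pos hθ0 β
          field_simp
    calc _ ≤ θ ^ β * (∑ n ∈ Finset.range M, |a n| +
          3 * C * (M : ℝ) ^ (β - 1) / ‖1 - Complex.exp (θ * Complex.I)‖) := by gcongr
      _ ≤ _ := by rw [mul_add]; exact add_le_add e1 e2
  rw [Metric.tendsto_nhds]
  intro ε hε
  have hK : Tendsto (fun K : ℝ => 3 * C / κ * K ^ (β - 1)) atTop (𝓝 0) := by
    simpa using (tendsto_rpow_neg_atTop (y := 1 - β) (by linarith)).const_mul (3 * C / κ)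
  obtain ⟨K, hKε, hK0⟩ :=
    ((hK.eventually (gt_mem_nhds (half_pos hε))).and (eventually_gt_atTop 0)).exists
  have hM : Tendsto (fun θ : ℝ => ⌈K / θ⌉₊) (𝓝[>] 0) atTop := by
    refine tendsto_nat_ceil_atTop.comp ?_
    exact (tendsto_inv_nhdsGT_zero.const_mul_atTop hK0).congr fun θ => (div_eq_mul_inv K θ).symm
  have hsM : Tendsto (fun θ : ℝ => (K + 1) ^ β * s ⌈K / θ⌉₊) (𝓝[>] 0) (𝓝 0) := by
    simpa using ((tendsto_sum_abs_div_rpow hβ0 hβ.le ha).comp hM).const_mul ((K + 1) ^ β)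
  filter_upwards [hsM.eventually (gt_mem_nhds (half_pos hε)),
    Ioo_mem_nhdsGT (zero_lt_one (α := ℝ))] with θ h1 h2
  have := bound K hK0 θ h2
  have h3 : (0 : ℝ) ≤ θ ^ β := Real.rpow_nonneg h2.1.le _
  rw [dist_zero_right, Real.norm_of_nonneg (by positivity)]
  linarith

end CLM

namespace CLM

/-! ### The binomial series as a model for the singularity -/

variable {β C : ℝ} {a : ℕ → ℝ}

lemma multichoose_eq_prod_div (β : ℝ) (n : ℕ) :
    Ring.multichoose β n = (∏ j ∈ Finset.range n, (β + j)) / n.factorial := by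
  have h1 : ∀ n : ℕ, (ascPochhammer ℝ n).eval β = ∏ j ∈ Finset.range n, (β + j) := by
    intro n
    induction n with
    | zero => simp
    | succ n ih => rw [ascPochhammer_succ_eval, ih, Finset.prod_range_succ]
  have h2 := Ring.factorial_nsmul_multichoose_eq_ascPochhammer β n
  rw [Polynomial.ascPochhammer_smeval_cast, Polynomial.ascPochhammer_smeval_eq_eval, h1,
    nsmul_eq_mul] at h2
  rw [← h2, mul_div_cancel_left₀ _ (by positivity)]

lemma multichoose_nonneg (hβ0 : 0 < β) (n : ℕ) : 0 ≤ Ring.multichoose β n := by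
  rw [multichoose_eq_prod_div]
  exact div_nonneg (Finset.prod_nonneg fun j _ => by positivity) (by positivity)

lemma multichoose_antitone (hβ0 : 0 < β) (hβ : β ≤ 1) :
    Antitone (fun n => Ring.multichoose β n) := by
  refine antitone_nat_of_succ_le fun n => ?_
  have h : Ring.multichoose β (n + 1) = Ring.multichoose β n * ((β + n) / (n + 1)) := by
    rw [multichoose_eq_prod_div, multichoose_eq_prod_div, Finset.prod_range_succ,
      Nat.factorial_succ]
    push_cast
    field_simp
  rw [h]
  refine mul_le_of_le_one_right (multichoose_nonneg hβ0 n) ?_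
  rw [div_le_one (by positivity)]
  linarith

/-- The binomial coefficients are asymptotic to `n ^ (β - 1) / Γ(β)`, by Euler's limit formula. -/
lemma tendsto_multichoose_div (hβ0 : 0 < β) :
    Tendsto (fun n : ℕ => Ring.multichoose β n / (n : ℝ) ^ (β - 1)) atTop
      (𝓝 (Real.Gamma β)⁻¹) := by
  have h1 := (Real.GammaSeq_tendsto_Gamma β).inv₀ (Real.Gamma_pos_of_pos hβ0).ne'
  have h2 : Tendsto (fun n : ℕ => (n : ℝ) / (n + β)) atTop (𝓝 1) :=
    tendsto_natCast_div_add_atTop β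
  have h3 := h1.mul h2
  rw [mul_one] at h3
  refine h3.congr' ?_
  filter_upwards [eventually_ge_atTop 1] with n hn
  have hn0 : (0 : ℝ) < n := by exact_mod_cast hn
  have hp := Real.rpow_pos_of_pos hn0 β
  have hq : (β + n : ℝ) ≠ 0 := by positivity
  rw [multichoose_eq_prod_div, Real.GammaSeq, Finset.prod_range_succ, Real.rpow_sub_one hn0.ne']
  have hprod : ∏ j ∈ Finset.range n, (β + j : ℝ) ≠ 0 :=
    Finset.prod_ne_zero_iff.2 fun j _ => by positivity
  rw [add_comm (n : ℝ) β]
  field_simp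

lemma exists_powerDecay_multichoose (hβ0 : 0 < β) (hβ : β ≤ 1) :
    ∃ C, PowerDecay β C (fun n => Ring.multichoose β n) := by
  obtain ⟨C, hC⟩ := (tendsto_multichoose_div hβ0).bddAbove_range
  refine ⟨C, .of_antitone (multichoose_nonneg hβ0) (multichoose_antitone hβ0 hβ) fun n hn => ?_⟩
  have hn0 : (0 : ℝ) < (n : ℝ) ^ (β - 1) := Real.rpow_pos_of_pos (by exact_mod_cast hn) _
  rw [← div_le_iff₀ hn0]
  exact hC ⟨n, rfl⟩

/-- The binomial series on the unit circle, obtained from the unit disc by Abel's limit theorem. -/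
lemma seriesSum_multichoose (hβ0 : 0 < β) (hβ : β < 1) {z : ℂ} (hz : ‖z‖ = 1) (hz1 : z ≠ 1) :
    seriesSum (fun n => Ring.multichoose β n) z = 1 / (1 - z) ^ (β : ℂ) := by
  obtain ⟨C, hC⟩ := exists_powerDecay_multichoose hβ0 hβ.le
  have habel := Complex.tendsto_tsum_powerSeries_nhdsWithin_lt (hC.tendsto_partialSum hβ hz hz1)
  rw [tendsto_map'_iff] at habel
  have hslit : 1 - z ∈ Complex.slitPlane := by
    left
    have hre : z.re < 1 := by
      refine lt_of_le_of_ne (hz ▸ Complex.re_le_norm z) fun h => hz1 ?_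
      have him : z.im = 0 := by
        have := Complex.sq_norm z
        rw [hz, Complex.normSq_apply, h] at this
        nlinarith
      exact Complex.ext (by simpa using h) (by simpa using him)
    simpa using hre
  have hcont : Tendsto (fun x : ℝ => 1 / (1 - z * (x : ℂ)) ^ (β : ℂ)) (𝓝[<] 1)
      (𝓝 (1 / (1 - z) ^ (β : ℂ))) := by
    have : ContinuousAt (fun x : ℝ => 1 / (1 - z * (x : ℂ)) ^ (β : ℂ)) 1 := by
      refine continuousAt_const.div (ContinuousAt.cpow (by fun_prop) continuousAt_const ?_) ?_
      · simpa using hslit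
      · have : (1 - z) ≠ 0 := sub_ne_zero.2 hz1.symm
        simp [Complex.cpow_eq_zero_iff, this]
    simpa [ContinuousAt] using this.tendsto.mono_left nhdsWithin_le_nhds
  refine tendsto_nhds_unique habel (hcont.congr' ?_)
  filter_upwards [Ioo_mem_nhdsLT (zero_lt_one (α := ℝ))] with x hx
  have hmem : z * (x : ℂ) ∈ Metric.eball (0 : ℂ) 1 := by
    rw [← ENNReal.ofReal_one, Metric.eball_ofReal]
    simpa [hz, abs_of_pos hx.1] using hx.2
  have hsum := (Complex.one_div_one_sub_cpow_hasFPowerSeriesOnBall_zero (β : ℂ)).hasSum hmem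
  rw [zero_add] at hsum
  rw [← hsum.tsum_eq]
  simp only [Function.comp_apply]
  refine tsum_congr fun n => ?_
  rw [FormalMultilinearSeries.ofScalars_apply_eq, ← Ring.multichoose_eq, smul_eq_mul, mul_pow,
    mul_assoc]
  congr 1
  exact (Ring.map_multichoose (algebraMap ℝ ℂ) β n).symm

lemma tendsto_one_sub_exp_div :
    Tendsto (fun θ : ℝ => (1 - Complex.exp (θ * Complex.I)) / θ) (𝓝[>] 0) (𝓝 (-Complex.I)) := by
  have hd : HasDerivAt (fun θ : ℝ => Complex.exp (θ * Complex.I)) Complex.I 0 := by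
    have h := (((hasDerivAt_id (0 : ℝ)).ofReal_comp).mul_const Complex.I).cexp
    simpa using h
  have := hd.tendsto_slope_zero_right.neg
  refine this.congr fun θ => ?_
  simp only [zero_add, Complex.ofReal_zero, zero_mul, Complex.exp_zero, Complex.real_smul,
    Complex.ofReal_inv]
  ring

lemma tendsto_rpow_mul_seriesSum_multichoose (hβ0 : 0 < β) (hβ : β < 1) :
    Tendsto (fun θ : ℝ => ((θ ^ β : ℝ) : ℂ) *
        seriesSum (fun n => Ring.multichoose β n) (Complex.exp (θ * Complex.I)))
      (𝓝[>] 0) (𝓝 (Complex.exp ((Real.pi * β / 2 : ℝ) * Complex.I))) := by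
  have hlim : (-Complex.I) ^ (-β : ℂ) = Complex.exp ((Real.pi * β / 2 : ℝ) * Complex.I) := by
    rw [Complex.cpow_def_of_ne_zero (by simp), Complex.log_neg_I]
    congr 1
    push_cast
    ring
  have hslit : -Complex.I ∈ Complex.slitPlane := by
    right
    simp
  rw [← hlim]
  have h := (tendsto_one_sub_exp_div.cpow tendsto_const_nhds hslit :
    Tendsto (fun θ : ℝ => ((1 - Complex.exp (θ * Complex.I)) / θ) ^ (-β : ℂ)) _ _)
  refine h.congr' ?_
  filter_upwards [Ioo_mem_nhdsGT (zero_lt_one (α := ℝ))] with θ hθ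
  have hθ1 := exp_mul_I_ne_one hθ.1.ne'
    (by rw [abs_of_pos hθ.1]; linarith [hθ.2, Real.pi_gt_three])
  have hne : 1 - Complex.exp (θ * Complex.I) ≠ 0 := sub_ne_zero.2 hθ1.symm
  have hθc : (θ : ℂ) ≠ 0 := by exact_mod_cast hθ.1.ne'
  rw [seriesSum_multichoose hβ0 hβ (Complex.norm_exp_ofReal_mul_I θ) hθ1, one_div,
    ← Complex.cpow_neg, Complex.ofReal_cpow hθ.1.le,
    Complex.cpow_def_of_ne_zero (div_ne_zero hne hθc), Complex.cpow_def_of_ne_zero hne,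
    Complex.cpow_def_of_ne_zero hθc, ← Complex.exp_add, div_eq_inv_mul, ← Complex.ofReal_inv,
    Complex.log_ofReal_mul (inv_pos.2 hθ.1) hne, Real.log_inv, Complex.ofReal_neg,
    Complex.ofReal_log hθ.1.le]
  congr 1
  ring

/-- The behaviour at `0+` of a trigonometric series whose coefficients are asymptotic to
`ℓ * n ^ (β - 1)`. Subtracting the multiple `ℓ * Γ(β)` of the binomial series leaves coefficients
that are `o(n ^ (β - 1))`. -/
theorem PowerDecay.tendsto_rpow_mul_seriesSum (h : PowerDecay β C a) (hβ0 : 0 < β) (hβ : β < 1)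
    {ℓ : ℝ} (ha : Tendsto (fun n : ℕ => a n / (n : ℝ) ^ (β - 1)) atTop (𝓝 ℓ)) :
    Tendsto (fun θ : ℝ => ((θ ^ β : ℝ) : ℂ) * seriesSum a (Complex.exp (θ * Complex.I)))
      (𝓝[>] 0)
      (𝓝 ((ℓ * Real.Gamma β : ℝ) * Complex.exp ((Real.pi * β / 2 : ℝ) * Complex.I))) := by
  obtain ⟨C', hq⟩ := exists_powerDecay_multichoose hβ0 hβ.le
  set s : ℝ := ℓ * Real.Gamma β with hs
  have hb := h.sub (hq.const_mul s)
  set b : ℕ → ℝ := fun n => a n - s * Ring.multichoose β n with hbdef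
  have hb0 : Tendsto (fun n : ℕ => b n / (n : ℝ) ^ (β - 1)) atTop (𝓝 0) := by
    have h1 := ha.sub ((tendsto_multichoose_div hβ0).const_mul s)
    rw [hs, mul_assoc, mul_inv_cancel₀ (Real.Gamma_pos_of_pos hβ0).ne', mul_one, sub_self] at h1
    exact h1.congr fun n => by rw [hbdef, hs]; ring
  have hsmall : Tendsto (fun θ : ℝ => ((θ ^ β : ℝ) : ℂ) *
      seriesSum b (Complex.exp (θ * Complex.I))) (𝓝[>] 0) (𝓝 0) := by
    rw [tendsto_zero_iff_norm_tendsto_zero]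
    refine (hb.tendsto_rpow_mul_norm_seriesSum hβ0 hβ hb0).congr' ?_
    filter_upwards [self_mem_nhdsWithin] with θ hθ
    rw [norm_mul, Complex.norm_real, Real.norm_of_nonneg (Real.rpow_nonneg (le_of_lt hθ) _)]
  have hmain := hsmall.add ((tendsto_rpow_mul_seriesSum_multichoose hβ0 hβ).const_mul (s : ℂ))
  rw [zero_add] at hmain
  refine hmain.congr' ?_
  filter_upwards [Ioo_mem_nhdsGT (zero_lt_one (α := ℝ))] with θ hθ
  have hz := Complex.norm_exp_ofReal_mul_I θ
  have hz1 := exp_mul_I_ne_one hθ.1.ne'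
    (by rw [abs_of_pos hθ.1]; linarith [hθ.2, Real.pi_gt_three])
  have hsum : seriesSum a (Complex.exp (θ * Complex.I)) =
      seriesSum b (Complex.exp (θ * Complex.I)) +
        s * seriesSum (fun n => Ring.multichoose β n) (Complex.exp (θ * Complex.I)) := by
    refine tendsto_nhds_unique (h.tendsto_partialSum hβ hz hz1)
      (((hb.tendsto_partialSum hβ hz hz1).add
        ((hq.tendsto_partialSum hβ hz hz1).const_mul (s : ℂ))).congr fun N => ?_)
    simp only [partialSum, Finset.mul_sum, ← Finset.sum_add_distrib, hbdef]
    refine Finset.sum_congr rfl fun n _ => ?_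
    push_cast
    ring
  rw [hsum]
  ring

end CLM

namespace CLM

/-! ### Quasi-monotone slowly varying coefficients -/

/-- Weighting by `n ^ (β - 1)` a nonnegative sequence with bounded dyadic block sums makes the block
sums decay geometrically. -/
lemma sum_Ico_mul_rpow_le_of_dyadic {β V : ℝ} (hβ : β < 1) {v : ℕ → ℝ} (hv : ∀ n, 0 ≤ v n)
    (hV : ∀ M, 1 ≤ M → ∑ n ∈ Finset.Ico M (2 * M), v n ≤ V) {M : ℕ} (hM : 1 ≤ M) (N : ℕ) :
    ∑ n ∈ Finset.Ico M N, v n * (n : ℝ) ^ (β - 1) ≤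
      V / (1 - 2 ^ (β - 1)) * (M : ℝ) ^ (β - 1) := by
  have hr : (2 : ℝ) ^ (β - 1) < 1 :=
    Real.rpow_lt_one_of_one_lt_of_neg one_lt_two (by linarith)
  have hr0 : 0 < 1 - (2 : ℝ) ^ (β - 1) := by linarith
  have hV0 : 0 ≤ V := (Finset.sum_nonneg fun n _ => hv n).trans (hV 1 le_rfl)
  have hblock : ∀ M N : ℕ, 1 ≤ M → N ≤ 2 * M →
      ∑ n ∈ Finset.Ico M N, v n * (n : ℝ) ^ (β - 1) ≤ V * (M : ℝ) ^ (β - 1) := by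
    intro M N hM hN
    calc ∑ n ∈ Finset.Ico M N, v n * (n : ℝ) ^ (β - 1)
        ≤ ∑ n ∈ Finset.Ico M N, v n * (M : ℝ) ^ (β - 1) := by
          refine Finset.sum_le_sum fun n hn => mul_le_mul_of_nonneg_left ?_ (hv n)
          exact Real.rpow_le_rpow_of_nonpos (by exact_mod_cast hM)
            (by exact_mod_cast (Finset.mem_Ico.1 hn).1) (by linarith)
      _ ≤ ∑ n ∈ Finset.Ico M (2 * M), v n * (M : ℝ) ^ (β - 1) :=
          Finset.sum_le_sum_of_subset_of_nonneg (Finset.Ico_subset_Ico_right hN)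
            fun n _ _ => mul_nonneg (hv n) (by positivity)
      _ ≤ _ := by
          rw [← Finset.sum_mul]
          exact mul_le_mul_of_nonneg_right (hV M hM) (by positivity)
  induction hk : N - M using Nat.strong_induction_on generalizing M with
  | _ k ih =>
    rcases le_total N (2 * M) with hN | hN
    · refine (hblock M N hM hN).trans (mul_le_mul_of_nonneg_right ?_ (by positivity))
      rw [le_div_iff₀ hr0]
      exact mul_le_of_le_one_right hV0 (by linarith [Real.rpow_nonneg zero_le_two (β - 1)])
    · rw [← Finset.sum_Ico_consecutive _ (by omega : M ≤ 2 * M) hN]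
      have h1 := hblock M (2 * M) hM le_rfl
      rcases hN.eq_or_lt with hN' | hN'
      · subst hN'
        rw [Finset.Ico_self, Finset.sum_empty, add_zero]
        refine h1.trans (mul_le_mul_of_nonneg_right ?_ (by positivity))
        rw [le_div_iff₀ hr0]
        exact mul_le_of_le_one_right hV0 (by linarith [Real.rpow_nonneg zero_le_two (β - 1)])
      have h2 := ih (N - 2 * M) (by omega) (M := 2 * M) (by omega) rfl
      rw [Nat.cast_mul, Nat.cast_ofNat, Real.mul_rpow zero_le_two M.cast_nonneg] at h2
      calc _ ≤ V * (M : ℝ) ^ (β - 1) +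
            V / (1 - 2 ^ (β - 1)) * (2 ^ (β - 1) * (M : ℝ) ^ (β - 1)) := add_le_add h1 h2
        _ = _ := by
          field_simp
          ring

/-- The two-point partition `{x, 2x}` of `(0, 2x]` in the definition of the Stieltjes integral. -/
lemma ofReal_rpow_mul_eVariationOn_le (δ : ℝ) (L : ℝ → ℝ) {x : ℝ} (hx : 0 < x) :
    ENNReal.ofReal (x ^ δ) * eVariationOn L (Icc x (2 * x)) ≤ variationIntegral δ L (2 * x) := by
  let u : ℕ → ℝ := fun i => if i = 0 then x else 2 * x
  have hu : Monotone u := monotone_nat_of_le_succ fun i => by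
    simp only [u, Nat.add_eq_zero_iff, one_ne_zero, and_false, if_false]
    split_ifs <;> linarith
  have hmem : ∀ i, u i ∈ Ioc 0 (2 * x) := fun i => by
    simp only [u]
    split_ifs <;> constructor <;> linarith
  refine le_trans ?_ (le_iSup _ (⟨1, ⟨u, hu, hmem⟩⟩ : ℕ × {u : ℕ → ℝ // Monotone u ∧
    ∀ i, u i ∈ Ioc 0 (2 * x)}))
  simp [u]

lemma ofReal_sum_abs_sub_le_eVariationOn (L : ℝ → ℝ) {M N : ℕ} {s : Set ℝ}
    (hs : ∀ i ∈ Icc M N, (i : ℝ) ∈ s) :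
    ENNReal.ofReal (∑ n ∈ Finset.Ico M N, |L ((n + 1 : ℕ) : ℝ) - L n|) ≤ eVariationOn L s := by
  rw [ENNReal.ofReal_sum_of_nonneg fun _ _ => abs_nonneg _]
  refine le_trans (le_of_eq ?_) (eVariationOn.sum_le_of_monotoneOn_Icc (f := L)
    (u := fun i : ℕ => (i : ℝ)) (Nat.mono_cast.monotoneOn _) hs)
  exact Finset.sum_congr rfl fun n _ => by rw [edist_dist, Real.dist_eq]

lemma exists_abs_le_of_tendsto {L : ℝ → ℝ} {ℓ : ℝ} (hlim : Tendsto L atTop (𝓝 ℓ)) :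
    ∃ B, ∀ n : ℕ, |L n| ≤ B := by
  obtain ⟨B, hB⟩ := (hlim.comp tendsto_natCast_atTop_atTop).abs.bddAbove_range
  exact ⟨B, fun n => hB ⟨n, rfl⟩⟩

/-- A bounded quasi-monotone function has bounded variation over dyadic blocks. -/
lemma IsQuasiMonotone.exists_dyadic_sum_le {L : ℝ → ℝ} (hL : IsQuasiMonotone L) {B : ℝ}
    (hB : ∀ n : ℕ, |L n| ≤ B) :
    ∃ V, ∀ M : ℕ, 1 ≤ M →
      ∑ n ∈ Finset.Ico M (2 * M), |L ((n + 1 : ℕ) : ℝ) - L n| ≤ V := by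
  obtain ⟨δ, hδ, C, hC⟩ := hL.integral_bound
  have hB0 : 0 ≤ B := (abs_nonneg _).trans (hB 0)
  have hC2 : ∀ᶠ M : ℕ in atTop, variationIntegral δ L (2 * M) ≤
      ENNReal.ofReal (C * ((2 * M : ℝ) ^ δ * L (2 * M))) :=
    (tendsto_natCast_atTop_atTop.const_mul_atTop (two_pos (α := ℝ))).eventually hC
  obtain ⟨M₀, hM₀⟩ := eventually_atTop.1 hC2
  set D := ∑ n ∈ Finset.range (2 * M₀), |L ((n + 1 : ℕ) : ℝ) - L n| with hD
  have hD0 : 0 ≤ D := Finset.sum_nonneg fun _ _ => abs_nonneg _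
  have hK0 : 0 ≤ |C| * 2 ^ δ * B := by positivity
  refine ⟨D + |C| * 2 ^ δ * B, fun M hM => ?_⟩
  rcases lt_or_ge M M₀ with hlt | hge
  · refine le_trans ?_ (le_add_of_nonneg_right hK0)
    refine Finset.sum_le_sum_of_subset_of_nonneg (fun n hn => ?_) fun _ _ _ => abs_nonneg _
    rw [Finset.mem_Ico] at hn
    rw [Finset.mem_range]
    omega
  · refine le_trans ?_ (le_add_of_nonneg_left hD0)
    have hMpos : (0 : ℝ) < M := by exact_mod_cast hM
    have hvar : ENNReal.ofReal (∑ n ∈ Finset.Ico M (2 * M), |L ((n + 1 : ℕ) : ℝ) - L n|) ≤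
        eVariationOn L (Icc (M : ℝ) (2 * M)) :=
      ofReal_sum_abs_sub_le_eVariationOn L fun i hi =>
        ⟨by exact_mod_cast hi.1, by exact_mod_cast hi.2⟩
    have h := (mul_le_mul_right hvar (ENNReal.ofReal ((M : ℝ) ^ δ))).trans
      ((ofReal_rpow_mul_eVariationOn_le δ L hMpos).trans (hM₀ M hge))
    have hpos : (0 : ℝ) < (M : ℝ) ^ δ := Real.rpow_pos_of_pos hMpos δ
    rw [← ENNReal.ofReal_mul hpos.le] at h
    have hle : C * ((2 * M : ℝ) ^ δ * L (2 * M)) ≤ (M : ℝ) ^ δ * (|C| * 2 ^ δ * B) := by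
      have h2M := hB (2 * M)
      push_cast at h2M
      calc C * ((2 * M : ℝ) ^ δ * L (2 * M)) ≤ |C * ((2 * M : ℝ) ^ δ * L (2 * M))| := le_abs_self _
        _ = |C| * ((2 * M : ℝ) ^ δ * |L (2 * M)|) := by
          rw [abs_mul, abs_mul, abs_of_nonneg (by positivity : (0 : ℝ) ≤ (2 * M : ℝ) ^ δ)]
        _ ≤ |C| * ((2 * M : ℝ) ^ δ * B) := by gcongr
        _ = _ := by
          rw [Real.mul_rpow zero_le_two hMpos.le]
          ring
    have h' := h.trans (ENNReal.ofReal_le_ofReal hle)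
    rw [ENNReal.ofReal_le_ofReal_iff (by positivity)] at h'
    exact le_of_mul_le_mul_left h' hpos

/-- The differences of `L n * n ^ (β - 1)` come from those of `L`, controlled over dyadic blocks,
and from those of the power, which telescope. -/
lemma IsQuasiMonotone.exists_powerDecay {L : ℝ → ℝ} (hL : IsQuasiMonotone L) {ℓ β : ℝ}
    (hlim : Tendsto L atTop (𝓝 ℓ)) (hβ : β < 1) {a : ℕ → ℝ}
    (ha : ∀ n : ℕ, 1 ≤ n → a n = L n * (n : ℝ) ^ (β - 1)) :
    ∃ C, PowerDecay β C a := by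
  obtain ⟨B, hB⟩ := exists_abs_le_of_tendsto hlim
  obtain ⟨V, hV⟩ := hL.exists_dyadic_sum_le hB
  have hB0 : 0 ≤ B := (abs_nonneg _).trans (hB 0)
  have hV0 : 0 ≤ V := (Finset.sum_nonneg fun _ _ => abs_nonneg _).trans (hV 1 le_rfl)
  have hr : (2 : ℝ) ^ (β - 1) < 1 :=
    Real.rpow_lt_one_of_one_lt_of_neg one_lt_two (by linarith)
  set W := V / (1 - 2 ^ (β - 1)) with hW
  have hW0 : 0 ≤ W := div_nonneg hV0 (by linarith)
  refine ⟨W + B, fun n hn => ?_, fun M N hM => ?_⟩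
  · rw [ha n hn, abs_mul, abs_of_nonneg (by positivity : (0 : ℝ) ≤ (n : ℝ) ^ (β - 1))]
    exact mul_le_mul_of_nonneg_right ((hB n).trans (le_add_of_nonneg_left hW0)) (by positivity)
  · have hpow : ∑ n ∈ Finset.Ico M N, ((n : ℝ) ^ (β - 1) - ((n + 1 : ℕ) : ℝ) ^ (β - 1)) ≤
        (M : ℝ) ^ (β - 1) := by
      rcases le_total N M with hNM | hMN
      · rw [Finset.Ico_eq_empty_of_le hNM, Finset.sum_empty]
        positivity
      · have := Finset.sum_Ico_sub (fun n : ℕ => -(n : ℝ) ^ (β - 1)) hMN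
        simp only [neg_sub_neg] at this
        rw [this]
        linarith [Real.rpow_nonneg N.cast_nonneg (β - 1)]
    have hdiff : ∀ n ∈ Finset.Ico M N, |a (n + 1) - a n| ≤
        |L ((n + 1 : ℕ) : ℝ) - L n| * (n : ℝ) ^ (β - 1) +
          B * ((n : ℝ) ^ (β - 1) - ((n + 1 : ℕ) : ℝ) ^ (β - 1)) := by
      intro n hn
      have hn1 : 1 ≤ n := hM.trans (Finset.mem_Ico.1 hn).1
      have hmono : ((n + 1 : ℕ) : ℝ) ^ (β - 1) ≤ (n : ℝ) ^ (β - 1) :=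
        Real.rpow_le_rpow_of_nonpos (by exact_mod_cast hn1) (by exact_mod_cast n.le_succ)
          (by linarith)
      rw [ha n hn1, ha (n + 1) (by omega)]
      have e : L ((n + 1 : ℕ) : ℝ) * ((n + 1 : ℕ) : ℝ) ^ (β - 1) - L n * (n : ℝ) ^ (β - 1) =
          (L ((n + 1 : ℕ) : ℝ) - L n) * (n : ℝ) ^ (β - 1) -
            L ((n + 1 : ℕ) : ℝ) * ((n : ℝ) ^ (β - 1) - ((n + 1 : ℕ) : ℝ) ^ (β - 1)) := by ring
      rw [e]
      refine (abs_sub _ _).trans (add_le_add (le_of_eq ?_) ?_)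
      · rw [abs_mul, abs_of_nonneg (by positivity : (0 : ℝ) ≤ (n : ℝ) ^ (β - 1))]
      · rw [abs_mul, abs_of_nonneg (sub_nonneg.2 hmono)]
        exact mul_le_mul_of_nonneg_right (hB (n + 1)) (sub_nonneg.2 hmono)
    refine (Finset.sum_le_sum hdiff).trans ?_
    rw [Finset.sum_add_distrib, ← Finset.mul_sum, add_mul]
    exact add_le_add (sum_Ico_mul_rpow_le_of_dyadic hβ (fun _ => abs_nonneg _) hV hM N)
      (mul_le_mul_of_nonneg_left hpow hB0)

end CLM

namespace CLM

/-! ### Fourier sums of an autocovariance function -/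

section Autocovariance

variable {Ω : Type*} [MeasurableSpace Ω] {μ : Measure Ω} {X : ℤ → Ω → ℝ}

lemma IsSecondOrderStationary.covariance_eq (hX : IsSecondOrderStationary μ X) (j k : ℤ) :
    covariance (X j) (X k) μ = acvf μ X (j - k) := by
  have := hX.cov_eq k (j - k)
  rwa [add_sub_cancel] at this

lemma IsSecondOrderStationary.acvf_neg (hX : IsSecondOrderStationary μ X) (h : ℤ) :
    acvf μ X (-h) = acvf μ X h := by
  have := hX.covariance_eq 0 h
  rw [zero_sub, covariance_comm] at this
  exact this.symm

/-- Autocovariances are positive semidefinite; the double sum is the sum of the variances of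
`∑ cos (j x) X_j` and `∑ sin (j x) X_j`. -/
lemma IsSecondOrderStationary.sum_sum_acvf_mul_cos_nonneg [IsFiniteMeasure μ]
    (hX : IsSecondOrderStationary μ X) (x : ℝ) (N : ℕ) :
    0 ≤ ∑ j ∈ Finset.range N, ∑ k ∈ Finset.range N,
      acvf μ X (j - k) * Real.cos ((j - k : ℝ) * x) := by
  have key : ∀ w : ℕ → ℝ, 0 ≤ ∑ j ∈ Finset.range N, ∑ k ∈ Finset.range N,
      w j * w k * acvf μ X (j - k) := by
    intro w
    have hmem : ∀ j ∈ Finset.range N, MemLp (fun ω => w j * X j ω) 2 μ := fun j _ =>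
      (hX.memLp j).const_mul (w j)
    have hvar := variance_nonneg (fun ω => ∑ j ∈ Finset.range N, w j * X j ω) μ
    rw [← covariance_self (memLp_finsetSum _ hmem).aestronglyMeasurable.aemeasurable,
      covariance_fun_sum_fun_sum' hmem hmem] at hvar
    refine hvar.trans_eq (Finset.sum_congr rfl fun j _ => Finset.sum_congr rfl fun k _ => ?_)
    rw [covariance_const_mul_left, covariance_const_mul_right, hX.covariance_eq]
    ring
  have h := add_nonneg (key fun j => Real.cos (j * x)) (key fun j => Real.sin (j * x))
  rw [← Finset.sum_add_distrib] at h
  refine h.trans_eq (Finset.sum_congr rfl fun j _ => ?_)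
  rw [← Finset.sum_add_distrib]
  refine Finset.sum_congr rfl fun k _ => ?_
  rw [sub_mul, Real.cos_sub]
  ring

/-- The symmetric partial sum `∑_{|k| < N} γ k * exp (i k x)` for an even `γ` (and `N ≥ 1`). -/
noncomputable def fourierSum (γ : ℤ → ℝ) (N : ℕ) (x : ℝ) : ℝ :=
  -γ 0 + 2 * ∑ k ∈ Finset.range N, γ k * Real.cos (k * x)

/-- Fejér's identity for the Cesàro sums. -/
lemma sum_fourierSum {γ : ℤ → ℝ} (hγ : ∀ h, γ (-h) = γ h) (x : ℝ) (N : ℕ) :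
    ∑ n ∈ Finset.range N, fourierSum γ (n + 1) x =
      ∑ j ∈ Finset.range N, ∑ k ∈ Finset.range N, γ (j - k) * Real.cos ((j - k : ℝ) * x) := by
  induction N with
  | zero => simp
  | succ N ih =>
    have hrow : ∑ k ∈ Finset.range N, γ (N - k) * Real.cos ((N - k : ℝ) * x) =
        ∑ j ∈ Finset.range N, γ ((j + 1 : ℕ) : ℤ) * Real.cos (((j + 1 : ℕ) : ℝ) * x) := by
      rw [← Finset.sum_range_reflect]
      refine Finset.sum_congr rfl fun k hk => ?_
      have hk := Finset.mem_range.1 hk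
      have e : ((N : ℤ) - ((N - 1 - k : ℕ) : ℤ)) = ((k + 1 : ℕ) : ℤ) := by omega
      have e' : ((N : ℝ) - ((N - 1 - k : ℕ) : ℝ)) = ((k + 1 : ℕ) : ℝ) := by exact_mod_cast e
      rw [e, e']
    have hcol : ∑ j ∈ Finset.range N, γ (j - N) * Real.cos ((j - N : ℝ) * x) =
        ∑ k ∈ Finset.range N, γ (N - k) * Real.cos ((N - k : ℝ) * x) := by
      refine Finset.sum_congr rfl fun k _ => ?_
      rw [← hγ, neg_sub, ← Real.cos_neg, ← neg_mul, neg_sub]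
    have hS : fourierSum γ (N + 1) x = γ 0 + 2 *
        ∑ j ∈ Finset.range N, γ ((j + 1 : ℕ) : ℤ) * Real.cos (((j + 1 : ℕ) : ℝ) * x) := by
      rw [fourierSum, Finset.sum_range_succ']
      simp only [Nat.cast_zero, zero_mul, Real.cos_zero]
      ring
    rw [Finset.sum_range_succ, ih, Finset.sum_range_succ]
    simp_rw [Finset.sum_range_succ]
    rw [Finset.sum_add_distrib, hcol, hrow, hS]
    simp only [sub_self, zero_mul, Real.cos_zero]
    ring

lemma IsSecondOrderStationary.nonneg_of_tendsto_fourierSum [IsFiniteMeasure μ]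
    (hX : IsSecondOrderStationary μ X) {x y : ℝ}
    (h : Tendsto (fun N => fourierSum (acvf μ X) N x) atTop (𝓝 y)) : 0 ≤ y := by
  refine ge_of_tendsto' ((tendsto_add_atTop_iff_nat 1).2 h).cesaro fun N => ?_
  rw [sum_fourierSum hX.acvf_neg]
  exact mul_nonneg (by positivity) (hX.sum_sum_acvf_mul_cos_nonneg x N)

end Autocovariance

lemma integral_exp_int_mul (n : ℤ) :
    ∫ x in -Real.pi..Real.pi, Complex.exp (Complex.I * n * x) =
      if n = 0 then (2 * Real.pi : ℂ) else 0 := by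
  split_ifs with h
  · subst h
    simp
    ring
  · have hn : Complex.I * n ≠ 0 := mul_ne_zero Complex.I_ne_zero (by exact_mod_cast h)
    rw [integral_exp_mul_complex hn, div_eq_zero_iff]
    left
    rw [sub_eq_zero, Complex.exp_eq_exp_iff_exists_int]
    exact ⟨n, by push_cast; ring⟩

lemma integral_exp_mul_cos (h : ℤ) (k : ℕ) :
    ∫ x in -Real.pi..Real.pi, Complex.exp (Complex.I * h * x) * (Real.cos (k * x) : ℂ) =
      (if h = -k then (Real.pi : ℂ) else 0) + if h = k then (Real.pi : ℂ) else 0 := by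
  have e : ∀ x : ℝ, Complex.exp (Complex.I * h * x) * (Real.cos (k * x) : ℂ) =
      (Complex.exp (Complex.I * ((h + k : ℤ) : ℂ) * x) +
        Complex.exp (Complex.I * ((h - k : ℤ) : ℂ) * x)) / 2 := by
    intro x
    rw [Complex.ofReal_cos, Complex.cos, ← mul_div_assoc, mul_add, ← Complex.exp_add,
      ← Complex.exp_add]
    push_cast
    ring_nf
  simp_rw [e]
  rw [intervalIntegral.integral_div, intervalIntegral.integral_add
    ((by fun_prop : Continuous _).intervalIntegrable _ _)
    ((by fun_prop : Continuous _).intervalIntegrable _ _),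
    integral_exp_int_mul, integral_exp_int_mul, add_div]
  congr 1
  · simp only [← eq_neg_iff_add_eq_zero]
    split_ifs <;> simp
  · simp only [sub_eq_zero]
    split_ifs <;> simp

/-- The Fourier coefficients of a partial sum are those of the series as soon as they are
included. -/
lemma integral_exp_mul_fourierSum {γ : ℤ → ℝ} (hγ : ∀ h, γ (-h) = γ h) (h : ℤ) {N : ℕ}
    (hN : h.natAbs < N) :
    ∫ x in -Real.pi..Real.pi, Complex.exp (Complex.I * h * x) * (fourierSum γ N x : ℂ) =
      2 * Real.pi * γ h := by
  have e : ∀ x : ℝ, Complex.exp (Complex.I * h * x) * (fourierSum γ N x : ℂ) =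
      -γ 0 * Complex.exp (Complex.I * h * x) + 2 * ∑ k ∈ Finset.range N,
        γ k * (Complex.exp (Complex.I * h * x) * (Real.cos (k * x) : ℂ)) := by
    intro x
    rw [fourierSum]
    push_cast
    rw [mul_add, Finset.mul_sum, Finset.mul_sum, Finset.mul_sum]
    congr 1
    · ring
    · exact Finset.sum_congr rfl fun k _ => by ring
  simp_rw [e]
  rw [intervalIntegral.integral_add ((by fun_prop : Continuous _).intervalIntegrable _ _)
    ((by fun_prop : Continuous _).intervalIntegrable _ _),
    intervalIntegral.integral_const_mul, intervalIntegral.integral_const_mul,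
    intervalIntegral.integral_finsetSum
      fun k _ => (by fun_prop : Continuous _).intervalIntegrable _ _]
  simp_rw [intervalIntegral.integral_const_mul, integral_exp_mul_cos]
  rw [integral_exp_int_mul]
  have hsum : ∑ k ∈ Finset.range N, (γ k : ℂ) *
      ((if h = -(k : ℤ) then (Real.pi : ℂ) else 0) + if h = (k : ℤ) then (Real.pi : ℂ) else 0) =
        if h = 0 then (2 * Real.pi * γ 0 : ℂ) else Real.pi * γ h := by
    rw [Finset.sum_eq_single_of_mem h.natAbs (Finset.mem_range.2 hN)]
    · have habs : γ h.natAbs = γ h := by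
        rcases Int.natAbs_eq h with h' | h'
        · rw [← h']
        · rw [← hγ, ← h']
      rw [habs]
      rcases eq_or_ne h 0 with rfl | h0
      · simp
        ring
      · rw [if_neg h0]
        rcases Int.natAbs_eq h with h' | h'
        · rw [if_neg (by omega), if_pos h']
          ring
        · rw [if_pos h', if_neg (by omega)]
          ring
    · intro k _ hk
      rw [if_neg (by omega), if_neg (by omega)]
      simp
  rw [hsum]
  split_ifs with h0
  · subst h0; ring
  · ring

/-- Convergence of the Fourier sums off a finite set, dominated by an integrable function, makes
their limit a spectral density. -/
lemma isSpectralDensity_of_tendsto {γ : ℤ → ℝ} (hγ : ∀ h, γ (-h) = γ h) {f g : ℝ → ℝ}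
    {s : Set ℝ} (hs : s.Finite) (hf : ∀ x ∈ Ioo (-Real.pi) Real.pi, 0 ≤ f x)
    (hlim : ∀ x ∈ Ioo (-Real.pi) Real.pi, x ∉ s →
      Tendsto (fun N => fourierSum γ N x) atTop (𝓝 (2 * Real.pi * f x)))
    (hg : IntegrableOn g (Ioo (-Real.pi) Real.pi))
    (hbound : ∀ N, ∀ x ∈ Ioo (-Real.pi) Real.pi, x ∉ s → |fourierSum γ N x| ≤ g x) :
    IsSpectralDensity γ f := by
  have hae : ∀ᵐ x ∂volume.restrict (Ioo (-Real.pi) Real.pi),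
      x ∈ Ioo (-Real.pi) Real.pi ∧ x ∉ s :=
    (ae_restrict_mem measurableSet_Ioo).and
      (ae_restrict_of_ae (measure_eq_zero_iff_ae_notMem.1 (hs.measure_zero volume)))
  have hcont : ∀ N, Continuous (fourierSum γ N) := fun N => by
    unfold fourierSum
    fun_prop
  have hlim' : ∀ᵐ x ∂volume.restrict (Ioo (-Real.pi) Real.pi),
      Tendsto (fun N => (2 * Real.pi)⁻¹ * fourierSum γ N x) atTop (𝓝 (f x)) := by
    filter_upwards [hae] with x hx
    have := (hlim x hx.1 hx.2).const_mul (2 * Real.pi)⁻¹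
    rwa [inv_mul_cancel_left₀ (by positivity)] at this
  have hmeas : AEStronglyMeasurable f (volume.restrict (Ioo (-Real.pi) Real.pi)) :=
    aestronglyMeasurable_of_tendsto_ae atTop
      (fun N => ((hcont N).const_mul _).aestronglyMeasurable) hlim'
  refine ⟨hf, (hg.const_mul (2 * Real.pi)⁻¹).mono' hmeas ?_, fun h => ?_⟩
  · filter_upwards [hae] with x hx
    rw [← div_eq_inv_mul, le_div_iff₀' (by positivity),
      ← Real.norm_of_nonneg (by positivity : 0 ≤ 2 * Real.pi), ← norm_mul]
    exact le_of_tendsto (hlim x hx.1 hx.2).norm (Eventually.of_forall fun N => hbound N x hx.1 hx.2)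
  · have hdom := tendsto_integral_of_dominated_convergence (μ := volume.restrict
      (Ioo (-Real.pi) Real.pi)) (F := fun (N : ℕ) (x : ℝ) =>
        Complex.exp (Complex.I * h * x) * (((2 * Real.pi)⁻¹ * fourierSum γ N x : ℝ) : ℂ))
      (f := fun x : ℝ => Complex.exp (Complex.I * h * x) * (f x : ℂ))
      (fun x => (2 * Real.pi)⁻¹ * g x)
      (fun N => (Continuous.mul (by fun_prop) (Complex.continuous_ofReal.comp
        ((hcont N).const_mul _))).aestronglyMeasurable)
      (hg.const_mul _) (fun N => ?_) ?_
    · refine tendsto_nhds_unique (tendsto_const_nhds.congr' ?_) hdom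
      filter_upwards [eventually_gt_atTop h.natAbs] with N hN
      rw [← integral_Ioc_eq_integral_Ioo,
        ← intervalIntegral.integral_of_le (by linarith [Real.pi_pos])]
      have e : ∀ x : ℝ, Complex.exp (Complex.I * h * x) *
          (((2 * Real.pi)⁻¹ * fourierSum γ N x : ℝ) : ℂ) = ((2 * Real.pi)⁻¹ : ℝ) *
            (Complex.exp (Complex.I * h * x) * (fourierSum γ N x : ℂ)) := fun x => by
        push_cast
        ring
      simp_rw [e]
      rw [intervalIntegral.integral_const_mul, integral_exp_mul_fourierSum hγ h hN]
      push_cast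
      have : (Real.pi : ℂ) ≠ 0 := by exact_mod_cast Real.pi_ne_zero
      field_simp
    · filter_upwards [hae] with x hx
      have hexp : ‖Complex.exp (Complex.I * h * x)‖ = 1 := by
        rw [mul_assoc, ← Complex.ofReal_intCast, ← Complex.ofReal_mul,
          Complex.norm_exp_I_mul_ofReal]
      rw [norm_mul, hexp, one_mul, Complex.norm_real, norm_mul,
        Real.norm_of_nonneg (by positivity : 0 ≤ (2 * Real.pi)⁻¹)]
      exact mul_le_mul_of_nonneg_left (hbound N x hx.1 hx.2) (by positivity)
    · filter_upwards [hlim'] with x hx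
      exact ((Complex.continuous_ofReal.tendsto _).comp hx).const_mul _

end CLM

namespace CLM

/-! ### Modulated coefficients -/

variable {β C C' lam : ℝ} {a b : ℕ → ℝ}

lemma re_partialSum_exp (a : ℕ → ℝ) (θ : ℝ) (N : ℕ) :
    (partialSum a (Complex.exp (θ * Complex.I)) N).re =
      ∑ n ∈ Finset.range N, a n * Real.cos (n * θ) := by
  rw [partialSum, Complex.re_sum]
  refine Finset.sum_congr rfl fun n _ => ?_
  rw [← Complex.exp_nat_mul, ← mul_assoc, ← Complex.ofReal_natCast, ← Complex.ofReal_mul,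
    Complex.re_ofReal_mul, Complex.exp_ofReal_mul_I_re]

lemma im_partialSum_exp (a : ℕ → ℝ) (θ : ℝ) (N : ℕ) :
    (partialSum a (Complex.exp (θ * Complex.I)) N).im =
      ∑ n ∈ Finset.range N, a n * Real.sin (n * θ) := by
  rw [partialSum, Complex.im_sum]
  refine Finset.sum_congr rfl fun n _ => ?_
  rw [← Complex.exp_nat_mul, ← mul_assoc, ← Complex.ofReal_natCast, ← Complex.ofReal_mul,
    Complex.im_ofReal_mul, Complex.exp_ofReal_mul_I_im]

/-- Modulating the coefficients by `cos (lam n)` and `sin (lam n)` translates the singularity from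
`0` to `± lam`. -/
lemma fourierSum_eq_of_modulated {γ : ℤ → ℝ}
    (hγ : ∀ n : ℕ, γ n = a n * Real.cos (lam * n) + b n * Real.sin (lam * n)) (N : ℕ) (x : ℝ) :
    fourierSum γ N x = -γ 0 +
      (partialSum a (Complex.exp ((x - lam : ℝ) * Complex.I)) N).re +
      (partialSum a (Complex.exp ((x + lam : ℝ) * Complex.I)) N).re +
      (partialSum b (Complex.exp ((x + lam : ℝ) * Complex.I)) N).im -
      (partialSum b (Complex.exp ((x - lam : ℝ) * Complex.I)) N).im := by
  simp only [re_partialSum_exp, im_partialSum_exp, fourierSum]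
  rw [add_assoc, add_assoc, add_sub_assoc, ← Finset.sum_add_distrib, ← Finset.sum_add_distrib,
    ← Finset.sum_sub_distrib, Finset.mul_sum]
  congr 1
  refine Finset.sum_congr rfl fun n _ => ?_
  rw [hγ n, mul_add (n : ℝ) x lam, mul_sub (n : ℝ) x lam, Real.cos_add, Real.cos_sub,
    Real.sin_add, Real.sin_sub, mul_comm lam]
  ring

/-- The limit of the Fourier sums of `a n * cos (lam n) + b n * sin (lam n)`. -/
noncomputable def modulatedSum (a b : ℕ → ℝ) (lam g₀ x : ℝ) : ℝ :=
  -g₀ + (seriesSum a (Complex.exp ((x - lam : ℝ) * Complex.I))).re +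
    (seriesSum a (Complex.exp ((x + lam : ℝ) * Complex.I))).re +
    (seriesSum b (Complex.exp ((x + lam : ℝ) * Complex.I))).im -
    (seriesSum b (Complex.exp ((x - lam : ℝ) * Complex.I))).im

lemma PowerDecay.tendsto_partialSum_exp (h : PowerDecay β C a) (hβ : β < 1) {θ : ℝ}
    (h0 : θ ≠ 0) (hθ : |θ| < 2 * Real.pi) :
    Tendsto (partialSum a (Complex.exp (θ * Complex.I))) atTop
      (𝓝 (seriesSum a (Complex.exp (θ * Complex.I)))) :=
  h.tendsto_partialSum hβ (Complex.norm_exp_ofReal_mul_I θ) (exp_mul_I_ne_one h0 hθ)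

lemma tendsto_fourierSum_modulated (ha : PowerDecay β C a) (hb : PowerDecay β C' b) (hβ : β < 1)
    (hlam : lam ∈ Ioo 0 Real.pi) {γ : ℤ → ℝ}
    (hγ : ∀ n : ℕ, γ n = a n * Real.cos (lam * n) + b n * Real.sin (lam * n)) {x : ℝ}
    (hx : x ∈ Ioo (-Real.pi) Real.pi) (hx' : x ∉ ({lam, -lam} : Set ℝ)) :
    Tendsto (fun N => fourierSum γ N x) atTop (𝓝 (modulatedSum a b lam (γ 0) x)) := by
  simp only [mem_insert_iff, mem_singleton_iff, not_or] at hx'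
  have h1 : x - lam ≠ 0 := sub_ne_zero.2 hx'.1
  have h2 : x + lam ≠ 0 := fun h => hx'.2 (by linarith)
  have h1' : |x - lam| < 2 * Real.pi := by
    rw [abs_lt]; constructor <;> linarith [hx.1, hx.2, hlam.1, hlam.2]
  have h2' : |x + lam| < 2 * Real.pi := by
    rw [abs_lt]; constructor <;> linarith [hx.1, hx.2, hlam.1, hlam.2]
  simp_rw [fourierSum_eq_of_modulated hγ]
  have re {u : ℕ → ℂ} {w : ℂ} (h : Tendsto u atTop (𝓝 w)) :
      Tendsto (fun N => (u N).re) atTop (𝓝 w.re) := (Complex.continuous_re.tendsto _).comp h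
  have im {u : ℕ → ℂ} {w : ℂ} (h : Tendsto u atTop (𝓝 w)) :
      Tendsto (fun N => (u N).im) atTop (𝓝 w.im) := (Complex.continuous_im.tendsto _).comp h
  exact (((tendsto_const_nhds.add (re (ha.tendsto_partialSum_exp hβ h1 h1'))).add
    (re (ha.tendsto_partialSum_exp hβ h2 h2'))).add
    (im (hb.tendsto_partialSum_exp hβ h2 h2'))).sub (im (hb.tendsto_partialSum_exp hβ h1 h1'))

lemma integrableOn_abs_sub_rpow_neg (hβ : β < 1) (y : ℝ) :
    IntegrableOn (fun x : ℝ => |x - y| ^ (-β)) (Ioo (-Real.pi) Real.pi) := by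
  have hloc : LocallyIntegrable (fun x : ℝ => |x| ^ (-β)) :=
    locallyIntegrable_of_norm_le_rpow (C := 1) (α := β) (by simp) (by simpa using hβ)
      (Eventually.of_forall fun x => by
        rw [one_mul, Real.norm_of_nonneg (by positivity), Real.norm_eq_abs])
      (by fun_prop : Measurable _).aestronglyMeasurable
  have hint : IntervalIntegrable (fun x : ℝ => |x| ^ (-β)) volume (-Real.pi - y) (Real.pi - y) :=
    (hloc.integrableOn_isCompact isCompact_uIcc).intervalIntegrable
  have h := hint.comp_sub_right y
  rw [sub_add_cancel, sub_add_cancel, intervalIntegrable_iff_integrableOn_Ioo_of_le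
    (by linarith [Real.pi_pos])] at h
  exact h

lemma exists_integrable_bound_fourierSum_modulated (ha : PowerDecay β C a)
    (hb : PowerDecay β C' b) (hβ0 : 0 < β) (hβ : β < 1) (hlam : lam ∈ Ioo 0 Real.pi) {γ : ℤ → ℝ}
    (hγ : ∀ n : ℕ, γ n = a n * Real.cos (lam * n) + b n * Real.sin (lam * n)) :
    ∃ g : ℝ → ℝ, IntegrableOn g (Ioo (-Real.pi) Real.pi) ∧
      ∀ N, ∀ x ∈ Ioo (-Real.pi) Real.pi, x ∉ ({lam, -lam} : Set ℝ) → |fourierSum γ N x| ≤ g x := by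
  have hT0 : 0 < Real.pi + lam := by linarith [hlam.1, Real.pi_pos]
  have hT : Real.pi + lam < 2 * Real.pi := by linarith [hlam.2]
  obtain ⟨K, hK0, hK⟩ := ha.exists_norm_partialSum_le hβ0 hβ hT0 hT
  obtain ⟨K', hK'0, hK'⟩ := hb.exists_norm_partialSum_le hβ0 hβ hT0 hT
  refine ⟨fun x => |γ 0| + (K + K') * |x - lam| ^ (-β) + (K + K') * |x - -lam| ^ (-β), ?_, ?_⟩
  · exact ((integrableOn_const (by simp)).add
      ((integrableOn_abs_sub_rpow_neg hβ lam).const_mul _)).add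
      ((integrableOn_abs_sub_rpow_neg hβ (-lam)).const_mul _)
  · intro N x hx hx'
    simp only [mem_insert_iff, mem_singleton_iff, not_or] at hx'
    have h1 : x - lam ≠ 0 := sub_ne_zero.2 hx'.1
    have h2 : x + lam ≠ 0 := fun h => hx'.2 (by linarith)
    have h1' : |x - lam| ≤ Real.pi + lam := by
      rw [abs_le]; constructor <;> linarith [hx.1, hx.2, hlam.1, hlam.2]
    have h2' : |x + lam| ≤ Real.pi + lam := by
      rw [abs_le]; constructor <;> linarith [hx.1, hx.2, hlam.1, hlam.2]
    have e1 := (Complex.abs_re_le_norm _).trans (hK _ h1 h1' N)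
    have e2 := (Complex.abs_re_le_norm _).trans (hK _ h2 h2' N)
    have e3 := (Complex.abs_im_le_norm _).trans (hK' _ h2 h2' N)
    have e4 := (Complex.abs_im_le_norm _).trans (hK' _ h1 h1' N)
    simp only [sub_neg_eq_add]
    rw [fourierSum_eq_of_modulated hγ]
    refine (abs_sub _ _).trans ?_
    have e5 := abs_add_le (-γ 0 + (partialSum a (Complex.exp ((x - lam : ℝ) * Complex.I)) N).re +
      (partialSum a (Complex.exp ((x + lam : ℝ) * Complex.I)) N).re)
      (partialSum b (Complex.exp ((x + lam : ℝ) * Complex.I)) N).im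
    have e6 := abs_add_three (-γ 0) (partialSum a (Complex.exp ((x - lam : ℝ) * Complex.I)) N).re
      (partialSum a (Complex.exp ((x + lam : ℝ) * Complex.I)) N).re
    rw [abs_neg] at e6
    linarith

lemma PowerDecay.seriesSum_exp_neg (h : PowerDecay β C a) (hβ : β < 1) {θ : ℝ}
    (h0 : θ ≠ 0) (hθ : |θ| < 2 * Real.pi) :
    seriesSum a (Complex.exp ((-θ : ℝ) * Complex.I)) =
      (starRingEnd ℂ) (seriesSum a (Complex.exp (θ * Complex.I))) := by
  refine tendsto_nhds_unique
    (h.tendsto_partialSum_exp hβ (neg_ne_zero.2 h0) (by rwa [abs_neg]))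
    (((Complex.continuous_conj.tendsto _).comp (h.tendsto_partialSum_exp hβ h0 hθ)).congr
      fun N => ?_)
  simp only [Function.comp_apply, partialSum, map_sum, map_mul, map_pow, Complex.conj_ofReal,
    ← Complex.exp_conj, Complex.conj_I]
  push_cast
  simp only [mul_neg, neg_mul]

/-- Away from the singularity the sum is bounded, hence negligible against `θ ^ (-β)`. -/
lemma PowerDecay.tendsto_rpow_mul_seriesSum_shift (h : PowerDecay β C a) (hβ0 : 0 < β)
    (hβ : β < 1) (hlam : lam ∈ Ioo 0 Real.pi) {ε : ℝ} (hε : |ε| = 1) :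
    Tendsto (fun θ : ℝ => ((θ ^ β : ℝ) : ℂ) *
      seriesSum a (Complex.exp ((lam + ε * θ + lam : ℝ) * Complex.I))) (𝓝[>] 0) (𝓝 0) := by
  have hT0 : 0 < Real.pi + lam := by linarith [hlam.1, Real.pi_pos]
  have hT : Real.pi + lam < 2 * Real.pi := by linarith [hlam.2]
  obtain ⟨K, hK0, hK⟩ := h.exists_norm_partialSum_le hβ0 hβ hT0 hT
  have hpow : Tendsto (fun θ : ℝ => θ ^ β * (K * lam ^ (-β))) (𝓝[>] 0) (𝓝 0) := by
    have : Tendsto (fun θ : ℝ => θ ^ β) (𝓝[>] 0) (𝓝 0) := by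
      have := (Real.continuousAt_rpow_const 0 β (Or.inr hβ0.le)).tendsto
      rw [Real.zero_rpow hβ0.ne'] at this
      exact this.mono_left nhdsWithin_le_nhds
    simpa using this.mul_const (K * lam ^ (-β))
  refine squeeze_zero_norm' ?_ hpow
  filter_upwards [Ioo_mem_nhdsGT (lt_min hlam.1 (sub_pos.2 hlam.2))] with θ hθ
  have hθ1 : θ < lam := hθ.2.trans_le (min_le_left _ _)
  have hθ2 : θ < Real.pi - lam := hθ.2.trans_le (min_le_right _ _)
  have habs : |ε * θ| = θ := by rw [abs_mul, hε, one_mul, abs_of_pos hθ.1]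
  have h1 := _root_.abs_le.1 habs.le
  have hpos : 0 < lam + ε * θ + lam := by linarith [hlam.1]
  have hle : |lam + ε * θ + lam| ≤ Real.pi + lam := by
    rw [abs_of_pos hpos]
    linarith
  rw [norm_mul, Complex.norm_real, Real.norm_of_nonneg (Real.rpow_nonneg hθ.1.le _)]
  refine mul_le_mul_of_nonneg_left ?_ (Real.rpow_nonneg hθ.1.le _)
  refine le_of_tendsto (h.tendsto_partialSum_exp hβ hpos.ne' (hle.trans_lt hT)).norm
    (Eventually.of_forall fun N => (hK _ hpos.ne' hle N).trans ?_)
  refine mul_le_mul_of_nonneg_left ?_ hK0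
  rw [abs_of_pos hpos]
  exact Real.rpow_le_rpow_of_nonpos hlam.1 (by linarith) (by linarith)

/-- The singularity at `lam`, on the right for `ε = 1` and on the left for `ε = -1`. Only the terms
at `x - lam` contribute, and the odd sine series makes the two sides differ. -/
theorem tendsto_rpow_mul_modulatedSum (ha : PowerDecay β C a) (hb : PowerDecay β C' b)
    (hβ0 : 0 < β) (hβ : β < 1) (hlam : lam ∈ Ioo 0 Real.pi) {A B : ℝ}
    (hA : Tendsto (fun n : ℕ => a n / (n : ℝ) ^ (β - 1)) atTop (𝓝 A))
    (hB : Tendsto (fun n : ℕ => b n / (n : ℝ) ^ (β - 1)) atTop (𝓝 B)) (g₀ : ℝ) {ε : ℝ}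
    (hε : ε = 1 ∨ ε = -1) :
    Tendsto (fun θ : ℝ => θ ^ β * modulatedSum a b lam g₀ (lam + ε * θ)) (𝓝[>] 0)
      (𝓝 (Real.Gamma β *
        (A * Real.cos (Real.pi * β / 2) - ε * B * Real.sin (Real.pi * β / 2)))) := by
  have hε1 : |ε| = 1 := by rcases hε with rfl | rfl <;> simp
  have re {u : ℝ → ℂ} {w : ℂ} (h : Tendsto u (𝓝[>] 0) (𝓝 w)) :
      Tendsto (fun N => (u N).re) (𝓝[>] 0) (𝓝 w.re) := (Complex.continuous_re.tendsto _).comp h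
  have im {u : ℝ → ℂ} {w : ℂ} (h : Tendsto u (𝓝[>] 0) (𝓝 w)) :
      Tendsto (fun N => (u N).im) (𝓝[>] 0) (𝓝 w.im) := (Complex.continuous_im.tendsto _).comp h
  have t0 : Tendsto (fun θ : ℝ => θ ^ β * -g₀) (𝓝[>] 0) (𝓝 0) := by
    have := (Real.continuousAt_rpow_const 0 β (Or.inr hβ0.le)).tendsto
    rw [Real.zero_rpow hβ0.ne'] at this
    simpa using (this.mono_left nhdsWithin_le_nhds).mul_const (-g₀)
  have t1 := re (ha.tendsto_rpow_mul_seriesSum hβ0 hβ hA)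
  have t2 := re (ha.tendsto_rpow_mul_seriesSum_shift hβ0 hβ hlam hε1)
  have t3 := im (hb.tendsto_rpow_mul_seriesSum_shift hβ0 hβ hlam hε1)
  have t4 := (im (hb.tendsto_rpow_mul_seriesSum hβ0 hβ hB)).const_mul ε
  simp only [Complex.re_ofReal_mul, Complex.im_ofReal_mul, Complex.exp_ofReal_mul_I_re,
    Complex.exp_ofReal_mul_I_im, Complex.zero_re, Complex.zero_im] at t1 t2 t3 t4
  have t := (((t0.add t1).add t2).add t3).sub t4
  have hlim : 0 + A * Real.Gamma β * Real.cos (Real.pi * β / 2) + 0 + 0 -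
      ε * (B * Real.Gamma β * Real.sin (Real.pi * β / 2)) = Real.Gamma β *
        (A * Real.cos (Real.pi * β / 2) - ε * B * Real.sin (Real.pi * β / 2)) := by ring
  rw [hlim] at t
  refine t.congr' ?_
  filter_upwards [Ioo_mem_nhdsGT (zero_lt_one (α := ℝ))] with θ hθ
  have hθ0 : θ ≠ 0 := hθ.1.ne'
  have hθ' : |θ| < 2 * Real.pi := by rw [abs_of_pos hθ.1]; linarith [hθ.2, Real.pi_gt_three]
  have hre : (seriesSum a (Complex.exp ((lam + ε * θ - lam : ℝ) * Complex.I))).re =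
      (seriesSum a (Complex.exp (θ * Complex.I))).re := by
    rw [add_sub_cancel_left]
    rcases hε with rfl | rfl
    · rw [one_mul]
    · rw [neg_one_mul, ha.seriesSum_exp_neg hβ hθ0 hθ', Complex.conj_re]
  have him : (seriesSum b (Complex.exp ((lam + ε * θ - lam : ℝ) * Complex.I))).im =
      ε * (seriesSum b (Complex.exp (θ * Complex.I))).im := by
    rw [add_sub_cancel_left]
    rcases hε with rfl | rfl
    · rw [one_mul, one_mul]
    · rw [neg_one_mul, neg_one_mul, hb.seriesSum_exp_neg hβ hθ0 hθ', Complex.conj_im]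
  rw [modulatedSum, hre, him]
  ring

end CLM

namespace CLM

/-! ### From the time domain to the spectral domain -/

lemma sign_neg_sin_mul_abs {c φ : ℝ} (hc : 0 < c) :
    Real.sign (-Real.sin φ) * |c * Real.sin φ| = -(c * Real.sin φ) := by
  rw [abs_mul, abs_of_pos hc, ← abs_neg (Real.sin φ)]
  rcases lt_trichotomy (-Real.sin φ) 0 with h | h | h
  · rw [Real.sign_of_neg h, abs_of_neg h]
    ring
  · simp [neg_eq_zero.1 h]
  · rw [Real.sign_of_pos h, abs_of_pos h]
    ring

/-- The remainder in the time domain is exactly what turns the constants `c * cos φ` and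
`-c * sin φ` into slowly varying functions. -/
lemma IsCLMTime.acvf_eq_modulated {Ω : Type*} [MeasurableSpace Ω] {μ : Measure Ω}
    {X : ℤ → Ω → ℝ} {lam d c φ : ℝ} {R L₁ L₂ : ℝ → ℝ} (hX : IsCLMTime μ X lam d c φ R)
    (hR : ∀ h : ℕ, 1 ≤ h →
      R h = (L₁ h - c * Real.cos φ) * Real.cos (lam * h) +
        Real.sign (-Real.sin φ) * (L₂ h - |c * Real.sin φ|) * Real.sin (lam * h))
    {n : ℕ} (hn : 1 ≤ n) :
    acvf μ X n = L₁ n * (n : ℝ) ^ (2 * d - 1) * Real.cos (lam * n) +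
      Real.sign (-Real.sin φ) * (L₂ n * (n : ℝ) ^ (2 * d - 1)) * Real.sin (lam * n) := by
  have hs := sign_neg_sin_mul_abs (φ := φ) hX.c_pos
  rw [hX.acvf_eq n hn, hR n hn, Real.cos_add]
  linear_combination (-(Real.sin (lam * n) * (n : ℝ) ^ (2 * d - 1))) * hs

/-- The passage to the spectral domain for an autocovariance function in modulated form. -/
theorem isCLMSpectral_of_modulated {Ω : Type*} [MeasurableSpace Ω] {μ : Measure Ω}
    [IsFiniteMeasure μ] {X : ℤ → Ω → ℝ} (hX : IsSecondOrderStationary μ X) {lam d : ℝ}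
    (hlam : lam ∈ Ioo 0 Real.pi) (hd : d ∈ Ioo (0 : ℝ) (1 / 2)) {a b : ℕ → ℝ} {C C' A B : ℝ}
    (ha : PowerDecay (2 * d) C a) (hb : PowerDecay (2 * d) C' b)
    (hA : Tendsto (fun n : ℕ => a n / (n : ℝ) ^ (2 * d - 1)) atTop (𝓝 A))
    (hB : Tendsto (fun n : ℕ => b n / (n : ℝ) ^ (2 * d - 1)) atTop (𝓝 B))
    (hγ : ∀ n : ℕ, acvf μ X n = a n * Real.cos (lam * n) + b n * Real.sin (lam * n))
    {cm cp : ℝ} (hcm : 0 < cm) (hcp : 0 < cp)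
    (hcm_eq : cm = Real.Gamma (2 * d) *
      (A * Real.cos (Real.pi * d) + B * Real.sin (Real.pi * d)) / (2 * Real.pi))
    (hcp_eq : cp = Real.Gamma (2 * d) *
      (A * Real.cos (Real.pi * d) - B * Real.sin (Real.pi * d)) / (2 * Real.pi)) :
    IsCLMSpectral μ X lam d cm cp := by
  have hβ0 : 0 < 2 * d := by linarith [hd.1]
  have hβ : 2 * d < 1 := by linarith [hd.2]
  have hπ : 0 < 2 * Real.pi := by positivity
  set F : ℝ → ℝ := modulatedSum a b lam (acvf μ X 0) with hF
  -- On `(-π, π)`, truncation at `0` matters at most at `± lam`, where the sum may diverge and `F` is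
  -- a junk value.
  set f : ℝ → ℝ := fun x => max 0 (F x / (2 * Real.pi)) with hf
  have hf0 : ∀ x, 0 ≤ f x := fun x => le_max_left _ _
  have hlim : ∀ x ∈ Ioo (-Real.pi) Real.pi, x ∉ ({lam, -lam} : Set ℝ) →
      Tendsto (fun N => fourierSum (acvf μ X) N x) atTop (𝓝 (2 * Real.pi * f x)) := by
    intro x hx hx'
    have h := tendsto_fourierSum_modulated ha hb hβ hlam hγ hx hx'
    have hnn : 0 ≤ F x := hX.nonneg_of_tendsto_fourierSum h
    have e : 2 * Real.pi * f x = F x := by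
      rw [hf]
      simp only
      rw [max_eq_right (div_nonneg hnn hπ.le), mul_div_cancel₀ _ hπ.ne']
    rw [e]
    exact h
  obtain ⟨g, hg, hbound⟩ := exists_integrable_bound_fourierSum_modulated ha hb hβ0 hβ hlam hγ
  have hside : ∀ ε : ℝ, ε = 1 ∨ ε = -1 → ∀ k : ℝ, 0 < k →
      k = Real.Gamma (2 * d) * (A * Real.cos (Real.pi * d) - ε * B * Real.sin (Real.pi * d)) /
        (2 * Real.pi) →
      Tendsto (fun y : ℝ => y ^ (2 * d) * f (lam + ε * y) - k) (𝓝[>] 0) (𝓝 0) := by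
    intro ε hε k hk hk_eq
    have h := (tendsto_rpow_mul_modulatedSum ha hb hβ0 hβ hlam hA hB (acvf μ X 0) hε).div_const
      (2 * Real.pi)
    rw [show Real.pi * (2 * d) / 2 = Real.pi * d by ring, ← hk_eq] at h
    have h' := (tendsto_const_nhds (x := (0 : ℝ))).max h
    rw [max_eq_right hk.le] at h'
    have h'' := h'.sub_const k
    rw [sub_self] at h''
    refine h''.congr' ?_
    filter_upwards [self_mem_nhdsWithin] with y hy
    have hy0 : 0 ≤ y ^ (2 * d) := Real.rpow_nonneg (le_of_lt hy) _
    rw [hf]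
    simp only
    rw [mul_max_of_nonneg _ _ hy0, mul_zero, mul_div_assoc]
  have hinv : ∀ y : ℝ, 0 < y → ∀ v k : ℝ,
      v = (k + (y ^ (2 * d) * v - k)) * y ^ (-2 * d) := by
    intro y hy v k
    rw [add_sub_cancel, mul_right_comm, ← Real.rpow_add hy]
    simp
  refine ⟨hX, hlam, hd, hcm.le, hcp.le, by linarith, f,
    fun y => y ^ (2 * d) * f (lam + -1 * y) - cm, fun y => y ^ (2 * d) * f (lam + 1 * y) - cp,
    isSpectralDensity_of_tendsto hX.acvf_neg (s := {lam, -lam}) (by simp)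
      (fun x _ => hf0 x) hlim hg hbound,
    fun y hy => ?_, fun y hy => ?_, hside (-1) (Or.inr rfl) cm hcm (by rw [hcm_eq]; ring),
    hside 1 (Or.inl rfl) cp hcp (by rw [hcp_eq]; ring), fun x hx => ?_, fun x hx => ?_⟩
  · have := mul_nonneg (Real.rpow_nonneg hy.le (2 * d)) (hf0 (lam + -1 * y))
    linarith
  · have := mul_nonneg (Real.rpow_nonneg hy.le (2 * d)) (hf0 (lam + 1 * y))
    linarith
  · beta_reduce
    rw [show lam + -1 * (lam - x) = x by ring]
    exact hinv (lam - x) (sub_pos.2 hx.2) (f x) cm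
  · beta_reduce
    rw [show lam + 1 * (x - lam) = x by ring]
    exact hinv (x - lam) (sub_pos.2 hx.1) (f x) cp

end CLM


theorem propositionC1 {Ω : Type*} [MeasurableSpace Ω] (μ : Measure Ω) [IsProbabilityMeasure μ]
    (X : ℤ → Ω → ℝ) (lam d c φ : ℝ) (R L₁ L₂ : ℝ → ℝ)
    (hX : CLM.IsCLMTime μ X lam d c φ R)
    (hφ : φ ∈ Ioo ((d - 1 / 2) * Real.pi) ((1 / 2 - d) * Real.pi))
    (hL₁ : CLM.IsQuasiMonotone L₁) (hL₂ : CLM.IsQuasiMonotone L₂)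
    (hR : ∀ h : ℕ, 1 ≤ h →
      R h = (L₁ h - c * Real.cos φ) * Real.cos (lam * h) +
        Real.sign (-Real.sin φ) * (L₂ h - |c * Real.sin φ|) * Real.sin (lam * h))
    (hlim₁ : Tendsto L₁ atTop (𝓝 (c * Real.cos φ)))
    (hlim₂ : φ ≠ 0 → Tendsto L₂ atTop (𝓝 |c * Real.sin φ|)) :
    CLM.IsCLMSpectral μ X lam d
        (c / (2 * Real.pi) * Real.Gamma (2 * d) * Real.cos (Real.pi * d + φ))
        (c / (2 * Real.pi) * Real.Gamma (2 * d) * Real.cos (Real.pi * d - φ)) ∧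
      0 < c / (2 * Real.pi) * Real.Gamma (2 * d) * Real.cos (Real.pi * d + φ) ∧
      0 < c / (2 * Real.pi) * Real.Gamma (2 * d) * Real.cos (Real.pi * d - φ) := by
  have hd := hX.d_mem
  have hc := hX.c_pos
  have hβ : 2 * d < 1 := by linarith [hd.2]
  have hπ := Real.pi_pos
  have hcos_pos : ∀ θ : ℝ, θ = Real.pi * d + φ ∨ θ = Real.pi * d - φ → 0 < Real.cos θ := by
    intro θ hθ
    have := mul_pos hπ hd.1
    refine Real.cos_pos_of_mem_Ioo ?_
    rcases hθ with rfl | rfl <;> constructor <;> nlinarith [hφ.1, hφ.2]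
  have hΓ : 0 < Real.Gamma (2 * d) := Real.Gamma_pos_of_pos (by linarith [hd.1])
  have hk : 0 < c / (2 * Real.pi) * Real.Gamma (2 * d) := by positivity
  have hcm := mul_pos hk (hcos_pos _ (Or.inl rfl))
  have hcp := mul_pos hk (hcos_pos _ (Or.inr rfl))
  refine ⟨?_, hcm, hcp⟩
  set s := Real.sign (-Real.sin φ) with hs
  set a : ℕ → ℝ := fun n =>
    if n = 0 then CLM.acvf μ X 0 else L₁ n * (n : ℝ) ^ (2 * d - 1) with ha_def
  have ha : ∀ n : ℕ, 1 ≤ n → a n = L₁ n * (n : ℝ) ^ (2 * d - 1) := fun n hn =>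
    if_neg (by omega)
  set b : ℕ → ℝ := fun n => s * (L₂ n * (n : ℝ) ^ (2 * d - 1)) with hb_def
  have hdiv : ∀ {L : ℝ → ℝ} {ℓ : ℝ}, Tendsto L atTop (𝓝 ℓ) →
      Tendsto (fun n : ℕ => L n * (n : ℝ) ^ (2 * d - 1) / (n : ℝ) ^ (2 * d - 1)) atTop (𝓝 ℓ) := by
    intro L ℓ hL
    refine (hL.comp tendsto_natCast_atTop_atTop).congr' ?_
    filter_upwards [eventually_ge_atTop 1] with n hn
    have : (0 : ℝ) < (n : ℝ) ^ (2 * d - 1) := Real.rpow_pos_of_pos (by exact_mod_cast hn) _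
    rw [Function.comp_apply, mul_div_cancel_right₀ _ this.ne']
  obtain ⟨C, hC⟩ := hL₁.exists_powerDecay hlim₁ hβ ha
  have hA : Tendsto (fun n : ℕ => a n / (n : ℝ) ^ (2 * d - 1)) atTop (𝓝 (c * Real.cos φ)) := by
    refine (hdiv hlim₁).congr' ?_
    filter_upwards [eventually_ge_atTop 1] with n hn
    rw [ha n hn]
  have hB : (∃ C', CLM.PowerDecay (2 * d) C' b) ∧
      Tendsto (fun n : ℕ => b n / (n : ℝ) ^ (2 * d - 1)) atTop (𝓝 (-(c * Real.sin φ))) := by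
    by_cases hφ0 : φ = 0
    · -- Here `sign 0 = 0`, so that `b = 0` whatever the behaviour of `L₂`.
      have hb0 : b = fun _ => 0 := by
        simp [hb_def, hs, hφ0]
      rw [hb0, hφ0]
      refine ⟨⟨0, fun n _ => by simp, fun M N _ => by simp⟩, ?_⟩
      simp
    · obtain ⟨C', hC'⟩ := hL₂.exists_powerDecay (hlim₂ hφ0) hβ
        (a := fun n => L₂ n * (n : ℝ) ^ (2 * d - 1)) fun _ _ => rfl
      refine ⟨⟨_, hC'.const_mul s⟩, ?_⟩
      have h := (hdiv (hlim₂ hφ0)).const_mul s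
      rw [hs, CLM.sign_neg_sin_mul_abs hc] at h
      exact h.congr fun n => (mul_div_assoc _ _ _).symm
  obtain ⟨⟨C', hC'⟩, hB⟩ := hB
  refine CLM.isCLMSpectral_of_modulated hX.stationary hX.lam_mem hd hC hC' hA hB (fun n => ?_)
    hcm hcp ?_ ?_
  · rcases Nat.eq_zero_or_pos n with rfl | hn
    · simp [ha_def]
    · rw [hX.acvf_eq_modulated hR hn, ha n hn]
  · rw [Real.cos_add]
    ring
  · rw [Real.cos_sub]
    ring
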